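/- **Setting.** A certificate is a pair $c=(u,pk_u)$ of a domain owner $u$ (owners are strings, ordered lexicographically) and a key; certificates are read as elements of $\mathbb Z_p^*$. Let $e:G\times G\to G_T$ be a non-degenerate bilinear map on groups of prime order $p$, $g$ a generator of $G$, $s\in\mathbb Z_p^*$ the trapdoor, and $h$ a polynomial-time computable keyed hash function family, collision-resistant against probabilistic polynomial-time (PPT) algorithms. The log maintainer answers each request to insert or revoke a certificate by a signed certificate timestamp (SCT); SCTs have strictly increasing times. $X$ is the set of active certificates at time $\tau$, obtained from the requests received up to $\tau$ by $X\mapsto X\cup\{c\}$ (insertion) and $X\mapsto X\setminus\{c\}$ (revocation). At time $\tau$ the maintainer publishes $g^s$, the accumulation value $A=g^{\prod_{x\in X}(x+s)}$, the root digest $digST$ of a searchTree (a binary search tree sorted by owner, whose nodes store an owner with a list of keys and are hashed as $h(\text{item},\text{left},\text{right})$), and the root digest $digCT'$ of a chronTree (a Merkle tree whose leaves are the log entries); the root digest $digCT$ of some chronTree was published earlier. **Proofs.** The auditor accepts a proof 1. (type 1: $c=(u,pk_u)$ is present) if it is a path of items and sibling hashes that starts at an item of $u$ listing $pk_u$ and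 hashes to $digST$; 2. (type 2: $c\notin X$) if it is a pair $(w,v)$ with $e(w,g^c g^s)=e(A g^{v},g)$; 3. (type 3: $u$ is absent) if it is the search path of $u$, ending at a leaf with an owner other than $u$, and hashes to $digST$; 4. (type 4: extension) if it is a sequence $h_1,h_2,\dots$ with $h(\cdots h(h(digCT,h_1),h_2)\cdots)=digCT'$; 5. (type 5: $c\in X$) if it is some $w$ with $e(w,g^c g^s)=e(A,g)$. The proof is *false* if, respectively, (1) the searchTree has no item of $u$ listing $pk_u$; (2) $c\in X$; (3) the searchTree has an item of $u$; (4) the leaf sequence of the earlier chronTree is not a prefix of that of the current one; (5) $c\notin X$. **Detection.** The participants (auditors, domain owners, certificate authorities, web users) form a finite connected network. Initially each holds the SCTs for its own requests, and the auditor holds the proof; in each of as many rounds as there are participants, everyone adds the information of its neighbours to its own. The domain owner of $c$ detects an inconsistency if, after this gossip, it knows an accepted proof of type 5 for $c$ at time $\tau$ although no SCT for an insertion of $c$ up to $\tau$ exists that is not followed by an SCT for a revocation of $c$ up to $\tau$, or an accepted proof of type 2 for $c$ although there is such an SCT. A proof is *detected* if the auditor rejects it or the domain owner concerned detects an inconsistency.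 **Lemma 4.** Consider a dishonest log maintainer who knows (even chooses) the trapdoor $s$ and the coins of the bilinear setup, and chooses the SCTs, the trees whose digests it publishes, the query and the proof. (a) Every false proof of type 2 or 5 is detected, whatever the computing power of the maintainer. (b) If the maintainer is a PPT algorithm that is given $1^\lambda$ and a uniformly random key of $h$, then the probability that it gives a false proof, of any of the five types, that is not detected is negligible in $\lambda$. (For types 1, 3 and 4 detection means that the auditor rejects.) -/

import Mathlib

open Filter

namespace CT

/-! ### A machine model with a step count -/

/-- The data on which algorithms work: finite binary trees (S-expressions). -/
inductive Data where
  | nil : Data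
  | pair : Data → Data → Data

namespace Data

/-- Number of nodes of a tree. -/
def size : Data → ℕ
  | nil => 1
  | pair a b => size a + size b + 1

def fst : Data → Data
  | nil => nil
  | pair a _ => a

def snd : Data → Data
  | nil => nil
  | pair _ b => b

/-- Structural recursion on trees. -/
def fold (b : Data) (s : Data → Data → Data → Data → Data) : Data → Data
  | nil => b
  | pair l r => s l r (fold b s l) (fold b s r)

/-- The sum of the costs `b` (at every leaf) and `s l r vl vr` (at every inner node `pair l r`,
where `vl`, `vr` are the values that a recursion `v` has returned on `l` and `r`). -/
def foldCost (v : Data → Data) (b : ℕ) (s : Data → Data → Data → Data → ℕ) : Data → ℕ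
  | nil => b
  | pair l r => foldCost v b s l + foldCost v b s r + s l r (v l) (v r)

def list : List Data → Data
  | [] => nil
  | a :: l => pair a (list l)

def bit : Bool → Data
  | false => nil
  | true => pair nil nil

/-- Bit strings as data. -/
def bits (l : List Bool) : Data := list (l.map bit)

/-- Natural numbers in binary. -/
def nat (n : ℕ) : Data := bits n.bits

/-- The string `1ⁿ`. -/
def unary (n : ℕ) : Data := bits (List.replicate n true)

def opt : Option Data → Data
  | none => nil
  | some a => pair a nil

end Data

/-- Programs. `fold b s` is the loop: on `(t, x)` it recurses over the tree `t`, with `b` run on `x`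
at every leaf and `s` run on `((l, r), ((result on l, result on r), x))` at every inner node. -/
inductive Code where
  | id : Code
  | nil : Code
  | fst : Code
  | snd : Code
  | eq : Code
  | pair : Code → Code → Code
  | comp : Code → Code → Code
  | cond : Code → Code → Code → Code
  | fold : Code → Code → Code

namespace Code

open Classical in
/-- The output of a program. -/
noncomputable def eval : Code → Data → Data
  | id, z => z
  | nil, _ => Data.nil
  | fst, z => z.fst
  | snd, z => z.snd
  | eq, z => Data.bit (decide (z.fst = z.snd))
  | pair f g, z => Data.pair (eval f z) (eval g z)
  | comp f g, z => eval f (eval g z)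
  | cond c f g, z => if eval c z = Data.nil then eval g z else eval f z
  | fold b s, z =>
      Data.fold (eval b z.snd)
        (fun l r vl vr => eval s (.pair (.pair l r) (.pair (.pair vl vr) z.snd))) z.fst

open Classical in
/-- The number of steps of a program. Each primitive operation costs the size of its argument (so
that sizes never exceed running times), and composite programs pay for all the parts that are run
and for the arguments that are handed on. Programs whose cost is polynomially bounded compute
exactly the polynomial-time functions. -/
noncomputable def cost : Code → Data → ℕ
  | id, z => z.size + 1
  | nil, _ => 1
  | fst, z => z.size + 1
  | snd, z => z.size + 1
  | eq, z => z.size + 2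
  | pair f g, z => cost f z + cost g z + 1
  | comp f g, z => cost g z + cost f (eval g z) + 1
  | cond c f g, z => cost c z + (if eval c z = Data.nil then cost g z else cost f z) + 1
  | fold b s, z =>
      z.size + 1 +
      Data.foldCost (eval (fold b s) <| Data.pair · z.snd)
        (z.snd.size + cost b z.snd + 1)
        (fun l r vl vr =>
          (Data.pair (.pair l r) (.pair (.pair vl vr) z.snd)).size +
            cost s (.pair (.pair l r) (.pair (.pair vl vr) z.snd)) + 1) z.fst

end Code

/-! ### Probability, negligible functions, collision-resistant hashing -/

/-- Probability of an event under the uniform distribution on a finite type. -/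
noncomputable def uniformProb (α : Type) [Fintype α] (E : α → Prop) : ℝ :=
  (Nat.card {a // E a} : ℝ) / (Fintype.card α : ℝ)

/-- `f` is smaller than every inverse polynomial, eventually. -/
def Negligible (f : ℕ → ℝ) : Prop :=
  ∀ c : ℕ, 0 < c → ∀ᶠ n : ℕ in atTop, f n < 1 / (n : ℝ) ^ c

/-- The input of an algorithm for security parameter `n`, hash key `k` and coin tosses `r`. -/
def algInput (n : ℕ) (k r : List Bool) : Data :=
  .pair (.unary n) (.pair (.bits k) (.bits r))

/-- `M` is a probabilistic polynomial-time algorithm that is given `1ⁿ` and a key of `keyLen n` bits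
and tosses `coins n` coins. -/
def IsPPT (keyLen coins : ℕ → ℕ) (M : Code) : Prop :=
  ∃ P : Polynomial ℕ, ∀ n, coins n ≤ P.eval n ∧
    ∀ k r : List Bool, k.length = keyLen n → r.length = coins n →
      M.cost (algInput n k r) ≤ P.eval n

/-- The probability, over a uniform key and uniform coins, that the output of `M` on security
parameter `n` satisfies `E` (which may depend on the key). -/
noncomputable def outputProb (keyLen coins : ℕ → ℕ) (M : Code) (n : ℕ)
    (E : List Bool → Data → Prop) : ℝ :=
  uniformProb ((Fin (keyLen n) → Bool) × (Fin (coins n) → Bool)) fun ω =>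
    E (List.ofFn ω.1) (M.eval (algInput n (List.ofFn ω.1) (List.ofFn ω.2)))

/-- A polynomial-time computable keyed family of hash functions with digests of `outLen n` bits. -/
structure HashFamily where
  keyLen : ℕ → ℕ
  outLen : ℕ → ℕ
  code : Code
  bound : Polynomial ℕ
  keyLen_le : ∀ n, keyLen n ≤ bound.eval n
  outLen_le : ∀ n, outLen n ≤ bound.eval n
  cost_le : ∀ n (k : List Bool) (x : Data), k.length = keyLen n →
    code.cost (.pair (.unary n) (.pair (.bits k) x)) ≤ bound.eval (n + x.size)
  digest : ∀ n (k : List Bool) (x : Data), k.length = keyLen n →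
    ∃ y : List Bool, y.length = outLen n ∧
      code.eval (.pair (.unary n) (.pair (.bits k) x)) = .bits y

namespace HashFamily

/-- The hash function `h` with security parameter `n` and key `k`. -/
noncomputable def hash (H : HashFamily) (n : ℕ) (k : List Bool) (x : Data) : Data :=
  H.code.eval (.pair (.unary n) (.pair (.bits k) x))

/-- No probabilistic polynomial-time algorithm finds two different messages with the same digest,
except with negligible probability. -/
def CollisionResistant (H : HashFamily) : Prop :=
  ∀ (coins : ℕ → ℕ) (M : Code), IsPPT H.keyLen coins M →
    Negligible fun n => outputProb H.keyLen coins M n fun k out =>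
      ∃ x y : Data, out = .pair x y ∧ x ≠ y ∧ H.hash n k x = H.hash n k y

end HashFamily

/-! ### Certificates, requests and signed certificate timestamps -/

/-- Domain owners are strings, ordered lexicographically. -/
abbrev Owner := List Bool

abbrev Key := List Bool

/-- `cert(u, pk_u)`. -/
abbrev Cert := Owner × Key

inductive Request where
  | insert : Cert → Request
  | revoke : Cert → Request

/-- A signed certificate timestamp: the log maintainer's receipt for a request. -/
structure SCT where
  time : ℕ
  request : Request

/-- The effect of a request on the set `X` of active certificates. -/
def Request.apply (X : Finset Cert) : Request → Finset Cert
  | insert c => X ∪ {c}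
  | revoke c => X \ {c}

/-- The set `X` of active certificates once the requests received up to time `τ` are processed. -/
def activeSet (L : List SCT) (τ : ℕ) : Finset Cert :=
  ((L.filter fun σ => σ.time ≤ τ).map SCT.request).foldl Request.apply ∅

/-! ### The bilinear-map accumulator -/

/-- A symmetric bilinear map on groups of prime order `p`, an encoding of the elements of `G` as
data, and the map by which certificates are read as elements of `ℤ_p^*`. -/
structure BilinearSetting where
  p : ℕ
  prime : p.Prime
  G : Type
  GT : Type
  [groupG : CommGroup G]
  [groupGT : CommGroup GT]
  card_G : Nat.card G = p
  card_GT : Nat.card GT = p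
  g : G
  generator : ∀ x : G, x ∈ Subgroup.zpowers g
  e : G → G → GT
  bilinear : ∀ (u v : G) (a b : ℕ), e (u ^ a) (v ^ b) = e u v ^ (a * b)
  nondegenerate : e g g ≠ 1
  enc : G → Data
  enc_injective : Function.Injective enc
  rep : Cert → (ZMod p)ˣ

attribute [instance] BilinearSetting.groupG BilinearSetting.groupGT

namespace BilinearSetting

/-- `g ^ a` for `a ∈ ℤ_p`. -/
def gpow (B : BilinearSetting) (a : ZMod B.p) : B.G := B.g ^ a.val

/-- The accumulation value `f_s(X) = g ^ ∏_{x ∈ X} (x + s)`. -/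
def accumulate (B : BilinearSetting) (s : (ZMod B.p)ˣ) (X : Finset Cert) : B.G :=
  B.gpow (∏ x ∈ X, ((B.rep x : ZMod B.p) + s))

end BilinearSetting

/-! ### The searchTree -/

/-- A data item `(u, List(pk_u))` of the searchTree. -/
abbrev SearchItem := Owner × List Key

def SearchItem.enc (d : SearchItem) : Data :=
  .pair (.bits d.1) (.list (d.2.map .bits))

inductive SearchTree where
  | empty : SearchTree
  | node : SearchTree → SearchItem → SearchTree → SearchTree

namespace SearchTree

/-- The data items in in-order. -/
def items : SearchTree → List SearchItem
  | empty => []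
  | node l d r => items l ++ d :: items r

/-- The in-order traversal lists the domain owners in strictly increasing lexicographic order. -/
def Sorted (S : SearchTree) : Prop := (S.items.map Prod.fst).Pairwise (· < ·)

def enc : SearchTree → Data
  | empty => .nil
  | node l d r => .pair d.enc (.pair (enc l) (enc r))

end SearchTree

/-- The hash value of a node of the searchTree, from its data item and the hash values of its left
and right child (`none` for a missing child). -/
noncomputable def searchHash (h : Data → Data) (d : SearchItem) (l r : Option Data) : Data :=
  h (.pair d.enc (.pair (.opt l) (.opt r)))

/-- The root digest `digST` (`none` for the empty tree). -/
noncomputable def SearchTree.digest (h : Data → Data) : SearchTree → Option Data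
  | empty => none
  | node l d r => some (searchHash h d (digest h l) (digest h r))

/-- A step up a search path: the data item of the parent, the side on which the path arrives
(`false` for left, `true` for right), and the hash value of the sibling, if there is one. -/
structure PathStep where
  item : SearchItem
  right : Bool
  sibling : Option Data

def PathStep.enc (a : PathStep) : Data :=
  .pair a.item.enc (.pair (.bit a.right) (.opt a.sibling))

/-- The hash value obtained from the hash value `v` of the parent's child on the path. -/
noncomputable def PathStep.up (h : Data → Data) (v : Data) (a : PathStep) : Data :=
  if a.right then searchHash h a.item a.sibling (some v) else searchHash h a.item (some v) a.sibling

/-! ### The chronTree -/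

/-- A leaf `(c, A, digST)` of the chronTree: the certificate (with key `none` after a revocation),
the encoded accumulation value and the root digest of the searchTree. -/
structure ChronItem where
  owner : Owner
  key : Option Key
  acc : Data
  digST : Option Data

def ChronItem.enc (x : ChronItem) : Data :=
  .pair (.pair (.bits x.owner) (.opt (x.key.map .bits))) (.pair x.acc (.opt x.digST))

inductive ChronTree where
  | leaf : ChronItem → ChronTree
  | node : ChronTree → ChronTree → ChronTree

/-- Labels of nodes of the chronTree: the data item at a leaf, a hash value at an inner node. -/
abbrev Label := ChronItem ⊕ Data

def Label.enc : Label → Data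
  | .inl x => .pair .nil x.enc
  | .inr v => .pair (.pair .nil .nil) v

/-- The label of an inner node, from the labels of its children. -/
noncomputable def chronHash (h : Data → Data) (a b : Label) : Label :=
  .inr (h (.pair a.enc b.enc))

namespace ChronTree

/-- The leaves in chronological (left-to-right) order. -/
def leaves : ChronTree → List ChronItem
  | leaf x => [x]
  | node l r => leaves l ++ leaves r

/-- The root digest `digCT`. -/
noncomputable def digest (h : Data → Data) : ChronTree → Label
  | leaf x => .inl x
  | node l r => chronHash h (digest h l) (digest h r)

def enc : ChronTree → Data
  | leaf x => .pair .nil x.enc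
  | node l r => .pair (.pair .nil .nil) (.pair (enc l) (enc r))

end ChronTree

/-! ### Queries, proofs and their verification -/

/-- The five types of queries. -/
inductive Query where
  /-- Type 1: is the certificate present? -/
  | presence : Cert → Query
  /-- Type 2: is the certificate absent from `X`? -/
  | absence : Cert → Query
  /-- Type 3: is the domain owner absent? -/
  | ownerAbsence : Owner → Query
  /-- Type 4: is the current chronTree an extension of the earlier one? -/
  | extension : Query
  /-- Type 5: is the certificate in `X`? -/
  | currency : Cert → Query

def Query.enc : Query → Data
  | presence c => .pair (.nat 1) (.pair (.bits c.1) (.bits c.2))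
  | absence c => .pair (.nat 2) (.pair (.bits c.1) (.bits c.2))
  | ownerAbsence u => .pair (.nat 3) (.bits u)
  | extension => .pair (.nat 4) .nil
  | currency c => .pair (.nat 5) (.pair (.bits c.1) (.bits c.2))

/-- The five types of proofs. -/
inductive Response (B : BilinearSetting) where
  /-- Type 1: the item `d₁` of the node, the hash values `h₁, h₂` of its children, and the path
  from the node to the root. -/
  | presence : SearchItem → Option Data → Option Data → List PathStep → Response B
  /-- Type 2: a non-membership witness `(w, v)`. -/
  | absence : B.G → ZMod B.p → Response B
  /-- Type 3: the item `d₁` of the leaf and the path from the leaf to the root. -/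
  | ownerAbsence : SearchItem → List PathStep → Response B
  /-- Type 4: the labels of the siblings. -/
  | extension : List Label → Response B
  /-- Type 5: a membership witness. -/
  | currency : B.G → Response B

def Response.enc {B : BilinearSetting} : Response B → Data
  | presence d a b path =>
      .pair (.nat 1) (.list [d.enc, .opt a, .opt b, .list (path.map PathStep.enc)])
  | absence w v => .pair (.nat 2) (.pair (B.enc w) (.nat v.val))
  | ownerAbsence d path => .pair (.nat 3) (.pair d.enc (.list (path.map PathStep.enc)))
  | extension hs => .pair (.nat 4) (.list (hs.map Label.enc))
  | currency w => .pair (.nat 5) (B.enc w)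

/-- The public parameters that enter the verification (besides `h`, `e` and `g`): `g ^ s`, the
accumulation value, the root digests, and the root digest of the chronTree published earlier. -/
structure PublicParams (B : BilinearSetting) where
  gs : B.G
  acc : B.G
  digST : Option Data
  digCTold : Label
  digCT : Label

/-- The auditor accepts the proof. In types 1 and 3 the auditor also reads the disclosed data items:
a proof of presence has to start at an item of `u` that lists `pk_u`, and a proof of absence of `u`
has to be the search path of `u`, ending at a leaf with a different owner. A proof of another type
than the query is rejected. -/
def Verify (h : Data → Data) {B : BilinearSetting} (pp : PublicParams B) :
    Query → Response B → Prop
  | .presence c, .presence d a b path =>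
      d.1 = c.1 ∧ c.2 ∈ d.2 ∧
      some (path.foldl (PathStep.up h) (searchHash h d a b)) = pp.digST
  | .absence c, .absence w v =>
      B.e w (B.gpow (B.rep c : ZMod B.p) * pp.gs) = B.e (pp.acc * B.gpow v) B.g
  | .ownerAbsence u, .ownerAbsence d path =>
      d.1 ≠ u ∧
      (∀ a ∈ path, if a.right then a.item.1 < u else u < a.item.1) ∧
      some (path.foldl (PathStep.up h) (searchHash h d none none)) = pp.digST
  | .extension, .extension hs => hs.foldl (chronHash h) pp.digCTold = pp.digCT
  | .currency c, .currency w =>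
      B.e w (B.gpow (B.rep c : ZMod B.p) * pp.gs) = B.e pp.acc B.g
  | _, _ => False

/-! ### The dishonest log maintainer -/

/-- What a dishonest log maintainer does. It runs the setup itself, so it picks the coins of the
bilinear setup and the trapdoor `s`; it issues receipts for requests; at time `now` it publishes the
parameters of its log, after having published the digest of some chronTree `oldChron` earlier (which
`chron` need not extend); and it answers `query` by `proof`. -/
structure Behaviour (BL : Data → BilinearSetting) where
  setupCoins : Data
  s : (ZMod (BL setupCoins).p)ˣ
  scts : List SCT
  scts_sorted : scts.Pairwise fun σ σ' => σ.time < σ'.time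
  now : ℕ
  search : SearchTree
  search_sorted : search.Sorted
  oldChron : ChronTree
  chron : ChronTree
  query : Query
  proof : Response (BL setupCoins)

def Request.enc : Request → Data
  | insert c => .pair .nil (.pair (.bits c.1) (.bits c.2))
  | revoke c => .pair (.pair .nil .nil) (.pair (.bits c.1) (.bits c.2))

namespace Behaviour

variable {BL : Data → BilinearSetting}

/-- The string that a log maintainer outputs. -/
def enc (F : Behaviour BL) : Data :=
  .list [F.setupCoins, .nat (F.s : ZMod (BL F.setupCoins).p).val,
    .list (F.scts.map fun σ => .pair (.nat σ.time) σ.request.enc), .nat F.now,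
    F.search.enc, F.oldChron.enc, F.chron.enc, F.query.enc, F.proof.enc]

/-- The set `X` of active certificates. -/
def active (F : Behaviour BL) : Finset Cert := activeSet F.scts F.now

/-- The published parameters. -/
noncomputable def params (h : Data → Data) (F : Behaviour BL) :
    PublicParams (BL F.setupCoins) where
  gs := (BL F.setupCoins).gpow F.s
  acc := (BL F.setupCoins).accumulate F.s F.active
  digST := F.search.digest h
  digCTold := F.oldChron.digest h
  digCT := F.chron.digest h

/-- What the proof claims to show is true of the log. -/
def ClaimTrue (F : Behaviour BL) : Prop :=
  match F.query with
  | .presence c => ∃ d ∈ F.search.items, d.1 = c.1 ∧ c.2 ∈ d.2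
  | .absence c => c ∉ F.active
  | .ownerAbsence u => ∀ d ∈ F.search.items, d.1 ≠ u
  | .extension => F.oldChron.leaves <+: F.chron.leaves
  | .currency c => c ∈ F.active

/-- The auditor accepts. -/
def Accepted (h : Data → Data) (F : Behaviour BL) : Prop :=
  Verify h (F.params h) F.query F.proof

end Behaviour

/-! ### Gossip -/

/-- Web users, auditors, domain owners and certificate authorities who exchange what they received
from the log maintainer along the edges of a connected graph. -/
structure GossipNetwork where
  V : Type
  [fintype : Fintype V]
  graph : SimpleGraph V
  connected : graph.Connected
  /-- The participant who acts for a domain owner. -/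
  ownerNode : Owner → V
  /-- The participant who made a request and got the receipt for it. -/
  holder : SCT → V
  /-- The participant who received the proof. -/
  auditor : V

attribute [instance] GossipNetwork.fintype

/-- Messages that are passed on: receipts, and proofs with the query that they answer and the time
of the public parameters that they refer to. -/
inductive Message (B : BilinearSetting) where
  | sct : SCT → Message B
  | proof : ℕ → Query → Response B → Message B

/-- One round of gossip: everyone adds to his view the views of his neighbours. -/
def gossipRound (N : GossipNetwork) {M : Type} (view : N.V → Set M) : N.V → Set M :=
  fun v => view v ∪ {m | ∃ w, N.graph.Adj v w ∧ m ∈ view w}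

/-- According to the receipts in a view, `c` has to be active at time `τ`: its insertion was
requested, and no revocation of it later on. -/
def PromisedActive {B : BilinearSetting} (view : Set (Message B)) (c : Cert) (τ : ℕ) : Prop :=
  ∃ t ≤ τ, Message.sct ⟨t, .insert c⟩ ∈ view ∧
    ∀ t', t < t' → t' ≤ τ → Message.sct ⟨t', .revoke c⟩ ∉ view

/-- The consistency check of the domain owner `u` on a view: some valid proof about a certificate
of `u` in the accumulator contradicts the receipts. -/
def Inconsistent (h : Data → Data) {B : BilinearSetting} (pp : ℕ → Option (PublicParams B))
    (view : Set (Message B)) (u : Owner) : Prop :=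
  ∃ τ P Q π, pp τ = some P ∧ Message.proof τ Q π ∈ view ∧ Verify h P Q π ∧
    ∃ c : Cert, c.1 = u ∧
      ((Q = .currency c ∧ ¬ PromisedActive view c τ) ∨
        (Q = .absence c ∧ PromisedActive view c τ))

namespace Behaviour

variable {BL : Data → BilinearSetting}

/-- Views before the gossip: everyone has the receipts for his own requests, and the auditor has the
proof. -/
def initialView (F : Behaviour BL) (N : GossipNetwork) (v : N.V) :
    Set (Message (BL F.setupCoins)) :=
  {m | (∃ σ ∈ F.scts, N.holder σ = v ∧ m = .sct σ) ∨
    (N.auditor = v ∧ m = .proof F.now F.query F.proof)}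

/-- Views after as many rounds of gossip as there are participants. -/
def finalView (F : Behaviour BL) (N : GossipNetwork) : N.V → Set (Message (BL F.setupCoins)) :=
  (gossipRound N)^[Fintype.card N.V] (F.initialView N)

/-- The domain owner `u` detects an inconsistency of the log by gossip. -/
def OwnerDetects (h : Data → Data) (F : Behaviour BL) (N : GossipNetwork) (u : Owner) : Prop :=
  Inconsistent h (fun τ => if τ = F.now then some (F.params h) else none)
    (F.finalView N (N.ownerNode u)) u

/-- The owner whom the query is about, if any. -/
def queryOwner (F : Behaviour BL) : Option Owner :=
  match F.query with
  | .presence c => some c.1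
  | .absence c => some c.1
  | .ownerAbsence u => some u
  | .extension => none
  | .currency c => some c.1

/-- The auditor rejects the proof, or the domain owner concerned detects an inconsistency. -/
def Detected (h : Data → Data) (F : Behaviour BL) (N : GossipNetwork) : Prop :=
  ¬ F.Accepted h ∨ ∃ u, F.queryOwner = some u ∧ F.OwnerDetects h N u

/-- The proof is of one of the types that rest on the accumulator. -/
def IsAccumulatorType (F : Behaviour BL) : Prop :=
  ∃ c : Cert, F.query = .absence c ∨ F.query = .currency c

end Behaviour

end CT

/-!
For the proofs that rest on the accumulator nothing cryptographic is used. Gossip over a connected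
network reaches everyone, so the owner of the certificate ends up with the proof and with all
receipts; the receipts determine the set of active certificates (`mem_activeSet_iff`), and an
accepted false proof contradicts them (`Behaviour.detected_of_isAccumulatorType`).

For the other types, the auditor's acceptance equates a root digest that the maintainer computed
honestly from a tree with one recomputed along the proof. If the hash function is injective on the
finitely many messages hashed on either side, the two computations can be matched from the root
downwards, and the claim of the proof holds: `SearchTree.mem_items_of_path`,
`SearchTree.not_mem_items_of_path` and `ChronTree.leaves_prefix_of_path`. So an accepted false proof
contains a collision.

It remains to find the collision in polynomial time by a program of the machine model. All hashed
messages are subtrees of one piece of data `Code.messages`, computed from the maintainer's output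
by a loop over each tree and over the path of the proof. A double loop over all subtrees
(`Code.collision`) then finds two that collide, so the messages need not be arranged in any
particular way, nor does the type of the proof have to be read. Running times are controlled by a
calculus of polynomial-time programs whose main rule is the one for loops
(`Code.PolyTime.fold`): a loop is fast if each pass only adds a polynomial amount of data to the two
results it receives. Hash values have polynomially bounded length, and every loop used here
copies each part of the results it receives at most once.
-/

namespace CT

/-! ### Polynomial running time -/

namespace Data

theorem size_pos (z : Data) : 1 ≤ z.size := by cases z <;> simp [size]

@[simp] theorem fst_pair (a b : Data) : (pair a b).fst = a := rfl

@[simp] theorem snd_pair (a b : Data) : (pair a b).snd = b := rfl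

theorem size_fst_add_size_snd (z : Data) : z.fst.size + z.snd.size ≤ z.size + 1 := by
  cases z with
  | nil => simp [size, fst, snd]
  | pair a b =>
    simp only [fst_pair, snd_pair, size]
    omega

theorem size_fst_le (z : Data) : z.fst.size ≤ z.size := by
  have := z.size_fst_add_size_snd
  have := z.snd.size_pos
  omega

theorem size_snd_le (z : Data) : z.snd.size ≤ z.size := by
  have := z.size_fst_add_size_snd
  have := z.fst.size_pos
  omega

theorem size_bit_le (b : Bool) : (bit b).size ≤ 3 := by cases b <;> simp [bit, size]

theorem size_bits_le (l : List Bool) : (bits l).size ≤ 4 * l.length + 1 := by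
  induction l with
  | nil => simp [bits, list, size]
  | cons a l ih =>
    simp only [bits, List.map_cons, list, size, List.length_cons] at ih ⊢
    cases a <;> simp only [bit, size] <;> omega

theorem le_size_unary (n : ℕ) : n ≤ (unary n).size := by
  induction n with
  | zero => simp
  | succ n ih =>
    simp only [unary, bits, List.replicate_succ, List.map_cons, list, size] at ih ⊢
    omega

end Data

theorem eval_le_eval (P : Polynomial ℕ) {a b : ℕ} (h : a ≤ b) : P.eval a ≤ P.eval b := by
  simp only [Polynomial.eval_eq_sum, Polynomial.sum_def]
  gcongr

/-- On the set `S`, the function `f` is bounded by a polynomial in the size of its argument. -/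
def PolyBounded (S : Set Data) (f : Data → ℕ) : Prop :=
  ∃ P : Polynomial ℕ, ∀ z ∈ S, f z ≤ P.eval z.size

namespace PolyBounded

variable {S T : Set Data} {f g : Data → ℕ}

theorem mono (hg : PolyBounded S g) (h : ∀ z ∈ S, f z ≤ g z) : PolyBounded S f :=
  let ⟨P, hP⟩ := hg
  ⟨P, fun z hz => (h z hz).trans (hP z hz)⟩

theorem const (c : ℕ) : PolyBounded S fun _ => c :=
  ⟨Polynomial.C c, fun _ _ => by simp⟩

theorem size : PolyBounded S Data.size := ⟨Polynomial.X, fun _ _ => by simp⟩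

theorem add (hf : PolyBounded S f) (hg : PolyBounded S g) : PolyBounded S fun z => f z + g z :=
  let ⟨P, hP⟩ := hf
  let ⟨Q, hQ⟩ := hg
  ⟨P + Q, fun z hz => by simpa using Nat.add_le_add (hP z hz) (hQ z hz)⟩

theorem mul (hf : PolyBounded S f) (hg : PolyBounded S g) : PolyBounded S fun z => f z * g z :=
  let ⟨P, hP⟩ := hf
  let ⟨Q, hQ⟩ := hg
  ⟨P * Q, fun z hz => by simpa using Nat.mul_le_mul (hP z hz) (hQ z hz)⟩

theorem eval (P : Polynomial ℕ) (hf : PolyBounded S f) : PolyBounded S fun z => P.eval (f z) :=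
  let ⟨Q, hQ⟩ := hf
  ⟨P.comp Q, fun z hz => by simpa using eval_le_eval P (hQ z hz)⟩

end PolyBounded

namespace Code

/-- Every primitive pays for the size of its argument, so running times bound outputs. -/
theorem size_eval_le_cost (c : Code) (z : Data) : (c.eval z).size ≤ c.cost z := by
  induction c generalizing z with
  | id => simp [eval, cost]
  | nil => simp [eval, cost, Data.size]
  | fst => simpa [eval, cost] using z.size_fst_le.trans (Nat.le_succ _)
  | snd => simpa [eval, cost] using z.size_snd_le.trans (Nat.le_succ _)
  | eq =>
    have := z.size_pos
    exact (Data.size_bit_le _).trans (by simp only [cost]; omega)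
  | pair f g hf hg =>
    have := hf z
    have := hg z
    simp only [eval, cost, Data.size]
    omega
  | comp f g hf hg =>
    have := hf (g.eval z)
    simp only [eval, cost]
    omega
  | cond c f g _ hf hg =>
    have := hf z
    have := hg z
    simp only [eval, cost]
    split_ifs <;> omega
  | fold b s hb hs =>
    have key : ∀ t x : Data,
        ((fold b s).eval (.pair t x)).size ≤ (fold b s).cost (.pair t x) := by
      intro t x
      cases t with
      | nil =>
        have := hb x
        simp only [eval, cost, Data.fold, Data.foldCost, Data.fst_pair, Data.snd_pair]
        omega
      | pair l r =>
        have := hs (.pair (.pair l r) (.pair (.pair ((fold b s).eval (.pair l x))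
          ((fold b s).eval (.pair r x))) x))
        simp only [eval, cost, Data.fold, Data.foldCost, Data.fst_pair, Data.snd_pair] at this ⊢
        omega
    cases z with
    | nil =>
      have := hb .nil
      simp only [eval, cost, Data.fold, Data.foldCost, Data.fst, Data.snd]
      omega
    | pair t x => exact key t x

/-- The program runs in polynomial time on the inputs in `S`. -/
def PolyTime (S : Set Data) (c : Code) : Prop := PolyBounded S c.cost

namespace PolyTime

variable {S T : Set Data} {b c f g s : Code}

theorem size_eval (hc : PolyTime S c) : PolyBounded S fun z => (c.eval z).size :=
  PolyBounded.mono hc fun z _ => c.size_eval_le_cost z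

theorem id : PolyTime S id := PolyBounded.size.add (.const 1)

theorem nil : PolyTime S nil := PolyBounded.const 1

theorem fst : PolyTime S fst := PolyBounded.size.add (.const 1)

theorem snd : PolyTime S snd := PolyBounded.size.add (.const 1)

theorem eq : PolyTime S eq := PolyBounded.size.add (.const 2)

theorem pair (hf : PolyTime S f) (hg : PolyTime S g) : PolyTime S (pair f g) :=
  (PolyBounded.add hf hg).add (.const 1)

theorem comp (hf : PolyTime T f) (hg : PolyTime S g) (h : ∀ z ∈ S, g.eval z ∈ T) :
    PolyTime S (comp f g) := by
  obtain ⟨P, hP⟩ := hf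
  refine ((PolyBounded.add hg (hg.size_eval.eval P)).add (.const 1)).mono fun z hz => ?_
  have := hP _ (h z hz)
  simp only [cost]
  omega

theorem cond (hc : PolyTime S c) (hf : PolyTime S f) (hg : PolyTime S g) :
    PolyTime S (cond c f g) := by
  refine ((PolyBounded.add hc (PolyBounded.add hf hg)).add (.const 1)).mono fun z _ => ?_
  simp only [cost]
  split_ifs <;> omega

/-- A loop runs in polynomial time if its body does and the body returns at most the two results
that it gets and a polynomial amount of new data. -/
theorem fold {B : Set Data} (hb : PolyTime B b) (hs : PolyTime T s)
    (hB : ∀ z ∈ S, z.snd ∈ B)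
    (hT : ∀ z ∈ S, ∀ l r vl vr, Data.pair (.pair l r) (.pair (.pair vl vr) z.snd) ∈ T)
    (hK : ∃ K : Polynomial ℕ, ∀ z ∈ S, ∀ l r vl vr : Data, l.size ≤ z.size → r.size ≤ z.size →
      (s.eval (.pair (.pair l r) (.pair (.pair vl vr) z.snd))).size ≤
        vl.size + vr.size + K.eval z.size) :
    PolyTime S (fold b s) := by
  obtain ⟨P, hP⟩ := hb
  obtain ⟨Q, hQ⟩ := hs
  obtain ⟨K, hK⟩ := hK
  -- At most `P + K` is added at each node, so the result on `t` is linear in the size of `t`.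
  have hval : ∀ z ∈ S, ∀ t : Data, t.size ≤ z.size →
      ((Code.fold b s).eval (.pair t z.snd)).size ≤
        (P.eval z.size + K.eval z.size) * t.size := by
    intro z hz t
    induction t with
    | nil =>
      intro _
      have h1 := b.size_eval_le_cost z.snd
      have h2 := hP _ (hB z hz)
      have h3 := eval_le_eval P z.size_snd_le
      simp only [eval, Data.fold, Data.fst_pair, Data.snd_pair, Data.size]
      omega
    | pair l r ihl ihr =>
      intro ht
      simp only [Data.size] at ht
      have h1 := ihl (by omega)
      have h2 := ihr (by omega)
      have h3 := hK z hz l r ((Code.fold b s).eval (.pair l z.snd))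
        ((Code.fold b s).eval (.pair r z.snd)) (by omega) (by omega)
      simp only [eval, Data.fold, Data.fst_pair, Data.snd_pair, Data.size, mul_add] at h1 h2 h3 ⊢
      omega
  -- `N` bounds the results, `D` the arguments of the body, and `C` the cost per node.
  let N : Polynomial ℕ := (P + K) * Polynomial.X
  let D : Polynomial ℕ := 2 * Polynomial.X + 2 * N + 4
  let C : Polynomial ℕ := Polynomial.X + P + D + Q.comp D + 1
  have hcost : ∀ z ∈ S, ∀ t : Data, t.size ≤ z.size →
      Data.foldCost (fun t => (Code.fold b s).eval (.pair t z.snd))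
        (z.snd.size + b.cost z.snd + 1)
        (fun l r vl vr =>
          (Data.pair (.pair l r) (.pair (.pair vl vr) z.snd)).size +
            s.cost (.pair (.pair l r) (.pair (.pair vl vr) z.snd)) + 1) t ≤
        C.eval z.size * t.size := by
    intro z hz t
    induction t with
    | nil =>
      intro _
      have h2 := hP _ (hB z hz)
      have h3 := eval_le_eval P z.size_snd_le
      have := z.size_snd_le
      simp only [Data.foldCost, Data.size, C, Polynomial.eval_add, Polynomial.eval_X,
        Polynomial.eval_one]
      omega
    | pair l r ihl ihr =>
      intro ht
      simp only [Data.size] at ht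
      have h1 := ihl (by omega)
      have h2 := ihr (by omega)
      have h3 : ∀ t : Data, t.size ≤ z.size →
          ((Code.fold b s).eval (.pair t z.snd)).size ≤ N.eval z.size := fun t ht => by
        simpa [N] using (hval z hz t ht).trans (Nat.mul_le_mul_left _ ht)
      have hl := h3 l (by omega)
      have hr := h3 r (by omega)
      have h4 := hQ _ (hT z hz l r ((Code.fold b s).eval (.pair l z.snd))
        ((Code.fold b s).eval (.pair r z.snd)))
      have h5 : (Data.pair (.pair l r) (.pair (.pair ((Code.fold b s).eval (.pair l z.snd))
          ((Code.fold b s).eval (.pair r z.snd))) z.snd)).size ≤ D.eval z.size := by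
        have := z.size_snd_le
        simp [D, Data.size]
        omega
      have h6 := eval_le_eval Q h5
      have h7 : C.eval z.size =
          z.size + P.eval z.size + D.eval z.size + Q.eval (D.eval z.size) + 1 := by
        simp [C]
      rw [Data.foldCost]
      simp only [Data.size, mul_add] at h1 h2 h4 h5 h6 ⊢
      omega
  refine ((PolyBounded.size.add (.const 1)).add
    ((PolyBounded.size.eval C).mul .size)).mono fun z hz => ?_
  have := (hcost z hz z.fst z.size_fst_le).trans (Nat.mul_le_mul_left _ z.size_fst_le)
  rw [cost]
  omega

end PolyTime

end Code

/-! ### Encodings are injective -/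

namespace Data

theorem bit_injective : Function.Injective bit := by
  rintro (_ | _) (_ | _) h <;> simp_all [bit]

theorem list_injective : Function.Injective list
  | [], [], _ => rfl
  | [], _ :: _, h => by simp [list] at h
  | _ :: _, [], h => by simp [list] at h
  | a :: l, b :: m, h => by
    simp only [list, pair.injEq] at h
    rw [h.1, list_injective h.2]

theorem bits_injective : Function.Injective bits :=
  list_injective.comp bit_injective.list_map

theorem opt_injective : Function.Injective opt := by
  rintro (_ | _) (_ | _) h <;> simp_all [opt]

end Data

theorem SearchItem.enc_injective : Function.Injective SearchItem.enc := by
  rintro ⟨u, l⟩ ⟨v, m⟩ h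
  simp only [SearchItem.enc, Data.pair.injEq] at h
  rw [Data.bits_injective h.1, Data.bits_injective.list_map (Data.list_injective h.2)]

theorem ChronItem.enc_injective : Function.Injective ChronItem.enc := by
  rintro ⟨u, k, a, d⟩ ⟨u', k', a', d'⟩ h
  simp only [ChronItem.enc, Data.pair.injEq] at h
  obtain ⟨⟨h1, h2⟩, h3, h4⟩ := h
  rw [Data.bits_injective h1,
    Option.map_injective Data.bits_injective (Data.opt_injective h2), h3, Data.opt_injective h4]

theorem Label.enc_injective : Function.Injective Label.enc := by
  rintro (x | v) (y | w) h <;> simp only [Label.enc, Data.pair.injEq, reduceCtorEq, false_and,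
    true_and] at h
  · rw [ChronItem.enc_injective h]
  · rw [h]

/-! ### Accepted hash proofs are true in the absence of collisions -/

section Soundness

variable (h : Data → Data) (T : Set Data)

/-- The message that is hashed at a node of the searchTree. -/
def searchMsg (d : SearchItem) (l r : Option Data) : Data := .pair d.enc (.pair (.opt l) (.opt r))

theorem searchMsg_inj {d d' : SearchItem} {l l' r r' : Option Data} :
    searchMsg d l r = searchMsg d' l' r' ↔ d = d' ∧ l = l' ∧ r = r' := by
  simp only [searchMsg, Data.pair.injEq, SearchItem.enc_injective.eq_iff,
    Data.opt_injective.eq_iff]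

/-- The message that is hashed at a step up a search path from a node with hash value `v`. -/
def PathStep.msg (v : Data) (a : PathStep) : Data :=
  if a.right then searchMsg a.item a.sibling (some v) else searchMsg a.item (some v) a.sibling

theorem PathStep.up_eq (v : Data) (a : PathStep) : a.up h v = h (a.msg v) := by
  unfold PathStep.up PathStep.msg searchHash searchMsg
  split_ifs <;> rfl

/-- The messages hashed in the computation of the root digest of a searchTree are in `T`. -/
def SearchTree.MsgsIn : SearchTree → Prop
  | empty => True
  | node l d r => searchMsg d (l.digest h) (r.digest h) ∈ T ∧ MsgsIn l ∧ MsgsIn r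

/-- The messages hashed on a search path that starts at a hash value are in `T`. -/
def pathMsgsIn : Data → List PathStep → Prop
  | _, [] => True
  | v, a :: p => a.msg v ∈ T ∧ pathMsgsIn (a.up h v) p

/-- The messages hashed in the computation of the root digest of a chronTree are in `T`. -/
def ChronTree.MsgsIn : ChronTree → Prop
  | leaf _ => True
  | node l r => Data.pair (l.digest h).enc (r.digest h).enc ∈ T ∧ MsgsIn l ∧ MsgsIn r

/-- The messages hashed in a proof of extension that starts at a label are in `T`. -/
def labelMsgsIn : Label → List Label → Prop
  | _, [] => True
  | v, a :: p => Data.pair v.enc a.enc ∈ T ∧ labelMsgsIn (chronHash h v a) p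

variable {h T}

theorem pathMsgsIn_concat {v : Data} {p : List PathStep} {a : PathStep} :
    pathMsgsIn h T v (p ++ [a]) ↔
      pathMsgsIn h T v p ∧ a.msg (p.foldl (PathStep.up h) v) ∈ T := by
  induction p generalizing v with
  | nil => simp [pathMsgsIn]
  | cons b p ih => simp [pathMsgsIn, ih, and_assoc]

theorem labelMsgsIn_concat {v : Label} {p : List Label} {a : Label} :
    labelMsgsIn h T v (p ++ [a]) ↔
      labelMsgsIn h T v p ∧ Data.pair (p.foldl (chronHash h) v).enc a.enc ∈ T := by
  induction p generalizing v with
  | nil => simp [labelMsgsIn]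
  | cons b p ih => simp [labelMsgsIn, ih, and_assoc]

/-- The top step of a path that hashes to the root digest runs through the root. -/
theorem SearchTree.top_step (hT : Set.InjOn h T) {S : SearchTree} (hS : S.MsgsIn h T) {v : Data}
    {a : PathStep} (ha : a.msg v ∈ T) (heq : some (a.up h v) = S.digest h) :
    ∃ l r, S = node l a.item r ∧
      if a.right then r.digest h = some v else l.digest h = some v := by
  cases S with
  | empty => simp [digest] at heq
  | node l d r =>
    rw [digest, Option.some_inj, PathStep.up_eq] at heq
    have := hT ha hS.1 heq
    unfold PathStep.msg at this
    split_ifs at this ⊢ with hr <;> rw [searchMsg_inj] at this <;>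
      exact ⟨l, r, by rw [this.1], by simp [this]⟩

/-- An accepted path from an item that hashes to the root digest lies in the tree. The path is
followed from the root downwards. -/
theorem SearchTree.mem_items_of_path (hT : Set.InjOn h T) {d : SearchItem} {x y : Option Data}
    (hd : searchMsg d x y ∈ T) (p : List PathStep) {S : SearchTree} (hS : S.MsgsIn h T)
    (hp : pathMsgsIn h T (searchHash h d x y) p)
    (heq : some (p.foldl (PathStep.up h) (searchHash h d x y)) = S.digest h) : d ∈ S.items := by
  induction p using List.reverseRecOn generalizing S with
  | nil =>
    cases S with
    | empty => simp [digest] at heq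
    | node l e r =>
      rw [List.foldl_nil, digest, Option.some_inj] at heq
      have := hT hd hS.1 heq
      rw [searchMsg_inj] at this
      simp [items, this.1]
  | append_singleton p a ih =>
    rw [pathMsgsIn_concat] at hp
    rw [List.foldl_append] at heq
    obtain ⟨l, r, rfl, hc⟩ := top_step hT hS hp.2 heq
    split_ifs at hc
    · simp [items, ih hS.2.2 hp.1 hc.symm]
    · simp [items, ih hS.2.1 hp.1 hc.symm]

theorem SearchTree.digest_eq_none {S : SearchTree} (hS : none = S.digest h) : S = empty := by
  cases S <;> simp_all [digest]

/-- If the search path of `u` ends at a leaf with another owner, then `u` is not in the tree: at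
each step down, the order excludes `u` from the subtree that is left aside. -/
theorem SearchTree.not_mem_items_of_path (hT : Set.InjOn h T) {d : SearchItem} {u : Owner}
    (hd : searchMsg d none none ∈ T) (hu : d.1 ≠ u) (p : List PathStep)
    (hpu : ∀ a ∈ p, if a.right then a.item.1 < u else u < a.item.1)
    {S : SearchTree} (hS : S.MsgsIn h T) (hsort : S.Sorted)
    (hp : pathMsgsIn h T (searchHash h d none none) p)
    (heq : some (p.foldl (PathStep.up h) (searchHash h d none none)) = S.digest h) :
    ∀ e ∈ S.items, e.1 ≠ u := by
  induction p using List.reverseRecOn generalizing S with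
  | nil =>
    cases S with
    | empty => simp [digest] at heq
    | node l e r =>
      rw [List.foldl_nil, digest, Option.some_inj] at heq
      have := hT hd hS.1 heq
      rw [searchMsg_inj] at this
      obtain ⟨rfl, hl, hr⟩ := this
      obtain rfl := digest_eq_none hl
      obtain rfl := digest_eq_none hr
      simpa [items] using hu
  | append_singleton p a ih =>
    rw [pathMsgsIn_concat] at hp
    rw [List.foldl_append] at heq
    obtain ⟨l, r, rfl, hc⟩ := top_step hT hS hp.2 heq
    have hau := hpu a (by simp)
    have hpu' := fun b hb => hpu b (List.mem_append_left _ hb)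
    simp only [Sorted, items, List.map_append, List.map_cons, List.pairwise_append,
      List.pairwise_cons, List.mem_cons, List.mem_map] at hsort
    obtain ⟨hsl, ⟨hdr, hsr⟩, hlr⟩ := hsort
    intro e he
    simp only [items, List.mem_append, List.mem_cons] at he
    split_ifs at hc hau
    · rcases he with he | rfl | he
      · exact ((hlr _ ⟨e, he, rfl⟩ _ (.inl rfl)).trans hau).ne
      · exact hau.ne
      · exact ih hpu' hS.2.2 hsr hp.1 hc.symm e he
    · rcases he with he | rfl | he
      · exact ih hpu' hS.2.1 hsl hp.1 hc.symm e he
      · exact hau.ne'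
      · exact (hau.trans (hdr _ ⟨e, he, rfl⟩)).ne'

/-- Labels of leaves and of inner nodes are told apart, so the digest also fixes the shape. -/
theorem ChronTree.digest_injective (hT : Set.InjOn h T) {t t' : ChronTree} (ht : t.MsgsIn h T)
    (ht' : t'.MsgsIn h T) (heq : t.digest h = t'.digest h) : t = t' := by
  induction t generalizing t' with
  | leaf x => cases t' <;> simp_all [digest, chronHash]
  | node l r ihl ihr =>
    cases t' with
    | leaf x => simp [digest, chronHash] at heq
    | node l' r' =>
      simp only [digest, chronHash, Sum.inr.injEq] at heq
      have := hT ht.1 ht'.1 heq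
      simp only [Data.pair.injEq, Label.enc_injective.eq_iff] at this
      rw [ihl ht.2.1 ht'.2.1 this.1, ihr ht.2.2 ht'.2.2 this.2]

/-- In a proof of extension, the earlier tree is found by going down along left children from the
root of the current one. -/
theorem ChronTree.leaves_prefix_of_path (hT : Set.InjOn h T) {t : ChronTree}
    (ht : t.MsgsIn h T) (p : List Label) {t' : ChronTree} (ht' : t'.MsgsIn h T)
    (hp : labelMsgsIn h T (t.digest h) p)
    (heq : p.foldl (chronHash h) (t.digest h) = t'.digest h) : t.leaves <+: t'.leaves := by
  induction p using List.reverseRecOn generalizing t' with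
  | nil => rw [digest_injective hT ht ht' heq]
  | append_singleton p a ih =>
    rw [labelMsgsIn_concat] at hp
    rw [List.foldl_append] at heq
    cases t' with
    | leaf x => simp [digest, chronHash] at heq
    | node l r =>
      simp only [List.foldl_cons, List.foldl_nil, digest, chronHash, Sum.inr.injEq] at heq
      have := hT hp.2 ht'.1 heq
      simp only [Data.pair.injEq, Label.enc_injective.eq_iff] at this
      exact (ih ht'.2.1 hp.1 this.1).trans (List.prefix_append _ _)

end Soundness

/-! ### Gossip and receipts -/

section Gossip

variable (N : GossipNetwork) {M : Type}

theorem subset_iterate_gossipRound (view : N.V → Set M) (m : ℕ) (v : N.V) :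
    view v ⊆ (gossipRound N)^[m] view v := by
  induction m with
  | zero => exact subset_rfl
  | succ m ih =>
    rw [Function.iterate_succ_apply']
    exact ih.trans Set.subset_union_left

theorem subset_iterate_gossipRound_of_walk (view : N.V → Set M) {v w : N.V}
    (p : N.graph.Walk v w) {m : ℕ} (hm : p.length ≤ m) :
    view w ⊆ (gossipRound N)^[m] view v := by
  induction p generalizing m with
  | nil => exact subset_iterate_gossipRound N view m _
  | cons hadj p ih =>
    obtain ⟨m, rfl⟩ : ∃ k, m = k + 1 := ⟨m - 1, by simp at hm; omega⟩
    rw [Function.iterate_succ_apply']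
    exact fun x hx => .inr ⟨_, hadj, ih (by simpa using hm) hx⟩

variable {N}

/-- A path in a network visits every participant at most once, so all information has reached
everyone after as many rounds as there are participants. -/
theorem Behaviour.mem_finalView {BL : Data → BilinearSetting} (F : Behaviour BL) {v w : N.V}
    {m : Message (BL F.setupCoins)} (hm : m ∈ F.initialView N w) : m ∈ F.finalView N v := by
  classical
  obtain ⟨p⟩ := N.connected.preconnected v w
  exact subset_iterate_gossipRound_of_walk N _ p.bypass p.bypass_isPath.length_lt.le hm

/-- Gossip creates no information. -/
theorem Behaviour.exists_initialView {BL : Data → BilinearSetting} (F : Behaviour BL) {v : N.V}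
    {m : Message (BL F.setupCoins)} (hm : m ∈ F.finalView N v) : ∃ w, m ∈ F.initialView N w := by
  have key : ∀ (k : ℕ) (v : N.V), m ∈ (gossipRound N)^[k] (F.initialView N) v →
      ∃ w, m ∈ F.initialView N w := by
    intro k
    induction k with
    | zero => exact fun v hv => ⟨v, hv⟩
    | succ k ih =>
      intro v hv
      rw [Function.iterate_succ_apply'] at hv
      rcases hv with hv | ⟨w, -, hw⟩
      · exact ih v hv
      · exact ih w hw
  exact key _ v hm

theorem Behaviour.sct_mem_finalView {BL : Data → BilinearSetting} (F : Behaviour BL) {v : N.V}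
    {σ : SCT} : Message.sct σ ∈ F.finalView N v ↔ σ ∈ F.scts := by
  constructor
  · intro h
    obtain ⟨w, ⟨σ', hσ', -, heq⟩ | ⟨-, h⟩⟩ := F.exists_initialView h
    · rw [Message.sct.inj heq]
      exact hσ'
    · cases h
  · exact fun h => F.mem_finalView (w := N.holder σ) (.inl ⟨σ, h, rfl, rfl⟩)

end Gossip

/-- A list of receipts promises that `c` is active at time `τ`. -/
def Promised (L : List SCT) (c : Cert) (τ : ℕ) : Prop :=
  ∃ t ≤ τ, ⟨t, .insert c⟩ ∈ L ∧ ∀ t', t < t' → t' ≤ τ → (⟨t', .revoke c⟩ : SCT) ∉ L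

theorem activeSet_concat (L : List SCT) (σ : SCT) (τ : ℕ) :
    activeSet (L ++ [σ]) τ =
      if σ.time ≤ τ then σ.request.apply (activeSet L τ) else activeSet L τ := by
  by_cases h : σ.time ≤ τ <;> simp [activeSet, h]

/-- As receipts are in the order of their times, those up to `τ` promise that `c` is active if and
only if the last of them about `c` is for an insertion. -/
theorem mem_activeSet_iff {L : List SCT} (hL : L.Pairwise fun σ σ' => σ.time < σ'.time) (c : Cert)
    (τ : ℕ) : c ∈ activeSet L τ ↔ Promised L c τ := by
  induction L using List.reverseRecOn with
  | nil => simp [activeSet, Promised]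
  | append_singleton L σ ih =>
    obtain ⟨h1, -, h3⟩ := List.pairwise_append.1 hL
    have hlt : ∀ ρ ∈ L, ρ.time < σ.time := fun ρ hρ => h3 ρ hρ σ (by simp)
    specialize ih h1
    rw [activeSet_concat]
    obtain ⟨t₀, q⟩ := σ
    -- A receipt that is not about `c`, or that is later than `τ`, does not matter.
    have hskip : (t₀ ≤ τ → q ≠ .insert c ∧ q ≠ .revoke c) →
        (Promised (L ++ [⟨t₀, q⟩]) c τ ↔ Promised L c τ) := by
      intro hq
      have hmem : ∀ t ≤ τ, ∀ r, r = .insert c ∨ r = .revoke c →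
          ((⟨t, r⟩ : SCT) ∈ L ++ [⟨t₀, q⟩] ↔ (⟨t, r⟩ : SCT) ∈ L) := by
        intro t ht r hr
        simp only [List.mem_append, List.mem_singleton, SCT.mk.injEq, or_iff_left_iff_imp]
        rintro ⟨rfl, rfl⟩
        have := hq ht
        tauto
      unfold Promised
      refine exists_congr fun t => and_congr_right fun ht => and_congr (hmem t ht _ (.inl rfl)) ?_
      exact forall_congr' fun t' => forall_congr' fun _ => forall_congr' fun ht' =>
        not_congr (hmem t' ht' _ (.inr rfl))
    split_ifs with hτ
    · cases q with
      | insert c' =>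
        by_cases hc : c = c'
        · subst hc
          simp only [Request.apply, Finset.mem_union, Finset.mem_singleton, or_true, true_iff]
          refine ⟨t₀, hτ, by simp, fun t' ht' _ hmem => ?_⟩
          simp only [List.mem_append, List.mem_singleton, SCT.mk.injEq, reduceCtorEq, and_false,
            or_false] at hmem
          exact absurd (hlt _ hmem) (by simpa using ht'.le)
        · rw [hskip fun _ => by simpa using Ne.symm hc]
          simpa [Request.apply, hc] using ih
      | revoke c' =>
        by_cases hc : c = c'
        · subst hc
          simp only [Request.apply, Finset.mem_sdiff, Finset.mem_singleton, not_true_eq_false,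
            and_false, false_iff]
          rintro ⟨t, -, hmem, hno⟩
          simp only [List.mem_append, List.mem_singleton, SCT.mk.injEq, reduceCtorEq, and_false,
            or_false] at hmem
          exact hno t₀ (hlt _ hmem) hτ (by simp)
        · rw [hskip fun _ => by simpa using Ne.symm hc]
          simpa [Request.apply, hc] using ih
    · rw [hskip fun h => absurd h hτ]
      exact ih

/-- A false accumulator proof contradicts the receipts, all of which, with the proof, reach the
owner of the certificate. -/
theorem Behaviour.detected_of_isAccumulatorType {BL : Data → BilinearSetting} (h : Data → Data)
    (N : GossipNetwork) (F : Behaviour BL) (hF : F.IsAccumulatorType) (hfalse : ¬ F.ClaimTrue) :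
    F.Detected h N := by
  by_cases hacc : F.Accepted h
  swap
  · exact .inl hacc
  have hprom : ∀ v c, PromisedActive (F.finalView N v) c F.now ↔ c ∈ F.active := by
    intro v c
    rw [active, mem_activeSet_iff F.scts_sorted]
    simp only [PromisedActive, Promised, F.sct_mem_finalView]
  obtain ⟨c, hc⟩ := hF
  refine .inr ⟨c.1, by rcases hc with hc | hc <;> simp [queryOwner, hc], F.now, F.params h,
    F.query, F.proof, if_pos rfl, F.mem_finalView (w := N.auditor) (.inr ⟨rfl, rfl⟩), hacc, c,
    rfl, ?_⟩
  rw [hprom]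
  rcases hc with hc | hc <;> simp [ClaimTrue, hc] at hfalse ⊢ <;> exact hfalse

/-! ### Searching a tree for a collision in polynomial time -/

namespace Data

/-- The subtrees of a tree that are not leaves. -/
def pairs : Data → Set Data
  | nil => ∅
  | pair l r => insert (pair l r) (pairs l ∪ pairs r)

theorem nil_notMem_pairs (t : Data) : nil ∉ pairs t := by
  induction t <;> simp_all [pairs]

theorem pairs_snd_subset (z : Data) : pairs z.snd ⊆ pairs z := by
  cases z with
  | nil => exact subset_rfl
  | pair a b => exact Set.subset_union_right.trans (Set.subset_insert _ _)

theorem pairs_pair_subset {a b : Data} {T : Set Data} :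
    pairs (pair a b) ⊆ T ↔ pair a b ∈ T ∧ pairs a ⊆ T ∧ pairs b ⊆ T := by
  simp only [pairs, Set.insert_subset_iff, Set.union_subset_iff]

/-- The value of a conditional: `b` if the test `t` returned `nil`, and `a` otherwise. -/
def ite (t a b : Data) : Data :=
  match t with
  | nil => b
  | pair _ _ => a

@[simp] theorem ite_nil (a b : Data) : ite nil a b = b := rfl

theorem ite_of_ne_nil {t : Data} (h : t ≠ nil) (a b : Data) : ite t a b = a := by
  cases t with
  | nil => exact absurd rfl h
  | pair => rfl

@[simp] theorem ite_bit (t : Bool) (a b : Data) : ite (bit t) a b = if t then a else b := by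
  cases t <;> rfl

theorem size_ite_le (t : Data) {a b : Data} {m : ℕ} (ha : a.size ≤ m) (hb : b.size ≤ m) :
    (ite t a b).size ≤ m := by
  cases t with
  | nil => exact hb
  | pair => exact ha

open Classical in
/-- The result of the program `Code.eq`. -/
noncomputable def same (a b : Data) : Data := bit (decide (a = b))

theorem ite_same_of_eq {x y : Data} (h : x = y) (a b : Data) : ite (same x y) a b = a := by
  simp [same, h]

theorem ite_same_of_ne {x y : Data} (h : x ≠ y) (a b : Data) : ite (same x y) a b = b := by
  simp [same, h]

/-- The first result other than `nil` of `p` at an inner node of a tree, or `nil`. -/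
def firstHit (p : Data → Data → Data) : Data → Data :=
  fold nil fun l r vl vr => ite vl vl (ite vr vr (p l r))

theorem firstHit_pair (p : Data → Data → Data) (l r : Data) :
    firstHit p (pair l r) =
      ite (firstHit p l) (firstHit p l) (ite (firstHit p r) (firstHit p r) (p l r)) := rfl

theorem exists_of_firstHit_ne_nil {p : Data → Data → Data} {t : Data} (h : firstHit p t ≠ nil) :
    ∃ l r, firstHit p t = p l r := by
  induction t with
  | nil => exact absurd rfl h
  | pair l r ihl ihr =>
    rw [firstHit_pair]
    by_cases h1 : firstHit p l = nil
    · by_cases h2 : firstHit p r = nil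
      · exact ⟨l, r, by rw [h1, h2, ite_nil, ite_nil]⟩
      · rw [h1, ite_nil, ite_of_ne_nil h2]
        exact ihr h2
    · rw [ite_of_ne_nil h1]
      exact ihl h1

theorem eq_nil_of_firstHit_eq_nil {p : Data → Data → Data} {t : Data} (h : firstHit p t = nil) :
    ∀ l r, pair l r ∈ pairs t → p l r = nil := by
  induction t with
  | nil => exact fun _ _ h => h.elim
  | pair a b iha ihb =>
    rw [firstHit_pair] at h
    have h1 : firstHit p a = nil := by
      by_contra h1
      exact h1 (by rwa [ite_of_ne_nil h1] at h)
    rw [h1, ite_nil] at h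
    have h2 : firstHit p b = nil := by
      by_contra h2
      exact h2 (by rwa [ite_of_ne_nil h2] at h)
    rw [h2, ite_nil] at h
    rintro l r (hlr | hlr | hlr)
    · cases hlr
      exact h
    · exact iha h1 l r hlr
    · exact ihb h2 l r hlr

/-- A collision of `h` among the inner subtrees of a tree, or `nil`. -/
noncomputable def collision (h : Data → Data) (t : Data) : Data :=
  firstHit (fun a b => firstHit (fun c d =>
    ite (same (pair a b) (pair c d)) nil
      (ite (same (h (pair a b)) (h (pair c d))) (pair (pair a b) (pair c d)) nil)) t) t

/-- The double search finds a collision if there is one. -/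
theorem collision_spec {h : Data → Data} {t : Data} (ht : ¬ Set.InjOn h (pairs t)) :
    ∃ x y, collision h t = pair x y ∧ x ≠ y ∧ h x = h y := by
  have hne : collision h t ≠ nil := by
    intro h0
    refine ht fun x hx y hy hxy => ?_
    by_contra hne
    cases x with
    | nil => exact nil_notMem_pairs _ hx
    | pair a b =>
      cases y with
      | nil => exact nil_notMem_pairs _ hy
      | pair c d =>
        have := eq_nil_of_firstHit_eq_nil (eq_nil_of_firstHit_eq_nil h0 a b hx) c d hy
        rw [ite_same_of_ne hne, ite_same_of_eq hxy] at this
        cases this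
  obtain ⟨a, b, hab⟩ := exists_of_firstHit_ne_nil hne
  change collision h t = _ at hab
  rw [hab] at hne ⊢
  obtain ⟨c, d, hcd⟩ := exists_of_firstHit_ne_nil hne
  rw [hcd] at hne ⊢
  by_cases h1 : pair a b = pair c d
  · exact absurd (ite_same_of_eq h1 _ _) hne
  rw [ite_same_of_ne h1] at hne ⊢
  by_cases h2 : h (pair a b) = h (pair c d)
  · exact ⟨_, _, ite_same_of_eq h2 _ _, h1, h2⟩
  · exact absurd (ite_same_of_ne h2 _ _) hne

end Data

namespace Code

section Eval

variable (b c f g s : Code) (z : Data)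

@[simp] theorem eval_id : id.eval z = z := rfl

@[simp] theorem eval_nil : nil.eval z = .nil := rfl

@[simp] theorem eval_fst : fst.eval z = z.fst := rfl

@[simp] theorem eval_snd : snd.eval z = z.snd := rfl

@[simp] theorem eval_eq : eq.eval z = .same z.fst z.snd := rfl

@[simp] theorem eval_pair : (pair f g).eval z = .pair (f.eval z) (g.eval z) := rfl

@[simp] theorem eval_comp : (comp f g).eval z = f.eval (g.eval z) := rfl

@[simp] theorem eval_cond : (cond c f g).eval z = .ite (c.eval z) (f.eval z) (g.eval z) := by
  rw [eval]
  split_ifs with h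
  · rw [h, Data.ite_nil]
  · rw [Data.ite_of_ne_nil h]

theorem eval_fold : (fold b s).eval z =
    Data.fold (b.eval z.snd)
      (fun l r vl vr => s.eval (.pair (.pair l r) (.pair (.pair vl vr) z.snd))) z.fst := rfl

end Eval

/-- Programs without loops. -/
def LoopFree : Code → Bool
  | pair f g => LoopFree f && LoopFree g
  | comp f g => LoopFree f && LoopFree g
  | cond c f g => LoopFree c && LoopFree f && LoopFree g
  | fold _ _ => false
  | _ => true

theorem PolyTime.of_loopFree {S : Set Data} {c : Code} (hc : c.LoopFree = true) :
    PolyTime S c := by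
  induction c generalizing S with
  | id => exact .id
  | nil => exact .nil
  | fst => exact .fst
  | snd => exact .snd
  | eq => exact .eq
  | pair f g hf hg =>
    simp only [LoopFree, Bool.and_eq_true] at hc
    exact (hf hc.1).pair (hg hc.2)
  | comp f g hf hg =>
    simp only [LoopFree, Bool.and_eq_true] at hc
    exact (hf (S := Set.univ) hc.1).comp (hg hc.2) fun _ _ => trivial
  | cond c f g hc' hf hg =>
    simp only [LoopFree, Bool.and_eq_true] at hc
    exact (hc' hc.1.1).cond (hf hc.1.2) (hg hc.2)
  | fold => cases hc

/-- In the body of a loop: the left child of the current node. -/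
abbrev left : Code := comp fst fst

/-- In the body of a loop: the right child of the current node. -/
abbrev right : Code := comp snd fst

/-- In the body of a loop: the result on the left child. -/
abbrev leftResult : Code := comp fst (comp fst snd)

/-- In the body of a loop: the result on the right child. -/
abbrev rightResult : Code := comp snd (comp fst snd)

/-- In the body of a loop: the argument of the loop besides the tree. -/
abbrev arg : Code := comp snd snd

end Code

namespace HashFamily

open Code

variable (H : HashFamily)

/-- The contexts `(1ⁿ, k)` in which the hash function can be computed. -/
def contexts : Set Data :=
  {c | ∃ n k, k.length = H.keyLen n ∧ c = .pair (.unary n) (.bits k)}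

/-- The hash function in the context `c`. -/
noncomputable def hashIn (c x : Data) : Data := H.code.eval (.pair c.fst (.pair c.snd x))

/-- The program that hashes the result of `m` in the context that is the result of `q`. -/
def hashCode (q m : Code) : Code :=
  comp H.code (pair (comp fst q) (pair (comp snd q) m))

@[simp] theorem eval_hashCode (q m : Code) (z : Data) :
    (H.hashCode q m).eval z = H.hashIn (q.eval z) (m.eval z) := rfl

variable {H} in
theorem polyTime_hashCode {S : Set Data} {q m : Code} (hq : PolyTime S q) (hm : PolyTime S m)
    (h : ∀ z ∈ S, q.eval z ∈ H.contexts) : PolyTime S (H.hashCode q m) := by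
  have hcode : PolyTime {z | ∃ c ∈ H.contexts, ∃ x, z = .pair c.fst (.pair c.snd x)} H.code := by
    refine (PolyBounded.size.eval H.bound).mono ?_
    rintro _ ⟨_, ⟨n, k, hk, rfl⟩, x, rfl⟩
    refine (H.cost_le n k x hk).trans (eval_le_eval _ ?_)
    have := Data.le_size_unary n
    simp only [Data.fst_pair, Data.snd_pair, Data.size]
    omega
  have hq' : ∀ c : Code, c.LoopFree = true → PolyTime S (comp c q) := fun c hc =>
    (PolyTime.of_loopFree (S := Set.univ) hc).comp hq fun _ _ => trivial
  exact hcode.comp ((hq' _ rfl).pair ((hq' _ rfl).pair hm)) fun z hz => ⟨_, h z hz, _, rfl⟩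

/-- Digests have `outLen n` bits, whatever the length of the message. -/
theorem exists_size_hashIn_le :
    ∃ P : Polynomial ℕ, ∀ c ∈ H.contexts, ∀ x, (H.hashIn c x).size ≤ P.eval c.size := by
  refine ⟨4 * H.bound + 1, ?_⟩
  rintro _ ⟨n, k, hk, rfl⟩ x
  obtain ⟨y, hy, hyx⟩ := H.digest n k x hk
  rw [hashIn, Data.fst_pair, Data.snd_pair, hyx]
  have h1 := Data.size_bits_le y
  have h2 := H.outLen_le n
  have h3 : H.bound.eval n ≤ H.bound.eval (Data.pair (.unary n) (.bits k)).size := by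
    apply eval_le_eval
    have := Data.le_size_unary n
    simp only [Data.size]
    omega
  simp only [Polynomial.eval_add, Polynomial.eval_mul, Polynomial.eval_ofNat, Polynomial.eval_one]
  omega

end HashFamily

namespace Code

variable (H : HashFamily)

/-- The loop that computes `Data.firstHit`, with body `p`. -/
def firstHit (p : Code) : Code :=
  fold nil (cond leftResult leftResult (cond rightResult rightResult p))

theorem eval_firstHit {p : Code} {z : Data} {f : Data → Data → Data}
    (hp : ∀ l r vl vr, p.eval (.pair (.pair l r) (.pair (.pair vl vr) z.snd)) = f l r) :
    (firstHit p).eval z = Data.firstHit f z.fst := by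
  simp [firstHit, eval_fold, Data.firstHit, hp]

theorem polyTime_firstHit {S T : Set Data} {p : Code} (hp : PolyTime T p)
    (hT : ∀ z ∈ S, ∀ l r vl vr, Data.pair (.pair l r) (.pair (.pair vl vr) z.snd) ∈ T)
    (hK : ∃ K : Polynomial ℕ, ∀ z ∈ S, ∀ l r vl vr : Data, l.size ≤ z.size → r.size ≤ z.size →
      (p.eval (.pair (.pair l r) (.pair (.pair vl vr) z.snd))).size ≤ K.eval z.size) :
    PolyTime S (firstHit p) := by
  obtain ⟨K, hK⟩ := hK
  refine PolyTime.fold (B := Set.univ) .nil (.cond (.of_loopFree rfl) (.of_loopFree rfl)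
    (.cond (.of_loopFree rfl) (.of_loopFree rfl) hp)) (fun _ _ => trivial) hT
    ⟨K, fun z hz l r vl vr hl hr => ?_⟩
  have := hK z hz l r vl vr hl hr
  simp only [eval_cond, eval_comp, eval_fst, eval_snd, Data.fst_pair, Data.snd_pair]
  exact Data.size_ite_le _ (by omega) (Data.size_ite_le _ (by omega) (by omega))

/-- On `(w, c, x)`: a pair `(x, y)` that collides in the context `c`, for an inner subtree `y`
of `w`. The first component of the argument of the body is the current subtree. -/
def partner : Code :=
  firstHit (cond (comp eq (pair (comp snd arg) fst)) nil
    (cond (comp eq (pair (H.hashCode (comp fst arg) (comp snd arg))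
        (H.hashCode (comp fst arg) fst)))
      (pair (comp snd arg) fst) nil))

/-- On `(w, c, w)`: a collision among the inner subtrees of `w` in the context `c`. -/
def collision : Code :=
  firstHit (comp (partner H) (pair (comp snd arg) (pair (comp fst arg) fst)))

theorem eval_collision (w c : Data) :
    (collision H).eval (.pair w (.pair c w)) = Data.collision (H.hashIn c) w := by
  refine eval_firstHit fun a b _ _ => ?_
  refine eval_firstHit fun c d _ _ => ?_
  simp

theorem polyTime_partner : PolyTime {z | z.snd.fst ∈ H.contexts} (partner H) := by
  refine polyTime_firstHit (T := {w | w.snd.snd.fst ∈ H.contexts}) ?_ (fun z hz _ _ _ _ => hz) ?_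
  · refine .cond (.of_loopFree rfl) .nil (.cond (.comp (T := Set.univ) .eq
      (.pair ?_ ?_) fun _ _ => trivial) (.of_loopFree rfl) .nil)
    · exact HashFamily.polyTime_hashCode (.of_loopFree rfl) (.of_loopFree rfl) fun z hz => hz
    · exact HashFamily.polyTime_hashCode (.of_loopFree rfl) (.of_loopFree rfl) fun z hz => hz
  · refine ⟨3 * Polynomial.X + 2, fun z _ l r vl vr hl hr => ?_⟩
    have h1 := z.snd.size_snd_le
    have h2 := z.size_snd_le
    have h3 := z.size_pos
    simp only [eval_cond, eval_nil, eval_pair, eval_comp, eval_fst, eval_snd, Data.fst_pair,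
      Data.snd_pair, Polynomial.eval_add, Polynomial.eval_mul, Polynomial.eval_ofNat,
      Polynomial.eval_X]
    have h4 : Data.nil.size ≤ 3 * z.size + 2 := by simp only [Data.size]; omega
    exact Data.size_ite_le _ h4 (Data.size_ite_le _ (by simp only [Data.size]; omega) h4)

theorem polyTime_collision : PolyTime {z | z.snd.fst ∈ H.contexts} (collision H) := by
  have hp : PolyTime {w | w.snd.snd.fst ∈ H.contexts}
      (comp (partner H) (pair (comp snd arg) (pair (comp fst arg) fst))) :=
    (polyTime_partner H).comp (.of_loopFree rfl) fun z hz => hz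
  refine polyTime_firstHit hp (fun z hz _ _ _ _ => hz) ?_
  obtain ⟨P, hP⟩ := (polyTime_partner H).size_eval
  refine ⟨P.comp (4 * Polynomial.X + 5), fun z hz l r vl vr hl hr => ?_⟩
  refine (hP (.pair z.snd.snd (.pair z.snd.fst (.pair l r))) hz).trans ?_
  rw [Polynomial.eval_comp]
  apply eval_le_eval
  have h1 := z.snd.size_fst_add_size_snd
  have h2 := z.size_snd_le
  simp only [Polynomial.eval_add, Polynomial.eval_mul, Polynomial.eval_ofNat, Polynomial.eval_X,
    Data.size]
  omega

end Code

/-! ### Programs that list the hashed messages -/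

namespace Data

/-- The loop over an encoded searchTree. On `t` it returns `((D t, D l, D r), m)`, where `D t`
encodes the digest of `t` as a searchTree, `l` and `r` are the children of `t` as data, and the
messages hashed on the way are subtrees of `m`. A node is encoded as `(item, (left, right))`, so its
digest is computed from the digests that the loop has returned for the children of
`(left, right)`. -/
def searchTrace (h : Data → Data) : Data → Data :=
  fold nil fun l _ vl vr =>
    pair (pair (pair (h (pair l vr.fst.snd)) nil) (pair vl.fst.fst vr.fst.fst))
      (pair (pair l vr.fst.snd) (pair vl.snd vr.snd))

/-- The same loop for the chronTree, where `D t` encodes the label of the root of `t`. -/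
def chronTrace (h : Data → Data) : Data → Data :=
  fold nil fun l r vl vr =>
    pair (pair (ite l (pair l (h vr.fst.snd)) (pair l r)) (pair vl.fst.fst vr.fst.fst))
      (pair vr.fst.snd (pair vl.snd vr.snd))

/-- A step on a path. A state `(v, rest, m)` consists of a value, the rest of the path, and data
whose subtrees include the messages hashed so far; `f (v, a)` is the message hashed at the step
`a`. Hash values are encoded as labels. -/
def walkStep (h f : Data → Data) (st : Data) : Data :=
  pair (pair (pair nil nil) (h (f (pair st.fst st.snd.fst.fst))))
    (pair st.snd.fst.snd (pair (f (pair st.fst st.snd.fst.fst)) st.snd.snd))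

/-- The final state of the walk along a path from the state `st`. -/
def walk (h f : Data → Data) (path st : Data) : Data :=
  fold st (fun _ _ _ vr => walkStep h f vr) path

/-- On `(v, a)`, where `v` encodes the hash value of a node as a label: the message hashed at the
step `a` of a search path. -/
def pathMsg (z : Data) : Data :=
  ite z.snd.snd.fst (pair z.snd.fst (pair z.snd.snd.snd (pair z.fst.snd nil)))
    (pair z.snd.fst (pair (pair z.fst.snd nil) z.snd.snd.snd))

theorem walk_list (h f : Data → Data) (l : List Data) (st : Data) :
    walk h f (list l) st = (walkStep h f)^[l.length] st := by
  induction l with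
  | nil => rfl
  | cons a l ih =>
    rw [List.length_cons, Function.iterate_succ_apply', ← ih]
    rfl

theorem walk_cons (h f : Data → Data) (a : Data) (l : List Data) (v m : Data) :
    walk h f (list (a :: l)) (pair v (pair (list (a :: l)) m)) =
      walk h f (list l) (pair (pair (pair nil nil) (h (f (pair v a))))
        (pair (list l) (pair (f (pair v a)) m))) := by
  rw [walk_list, walk_list, List.length_cons, Function.iterate_succ_apply]
  rfl

end Data

section Traces

variable (h : Data → Data)

/-- On an encoded searchTree the loop computes the digest and collects the messages. -/
theorem searchTrace_enc (S : SearchTree) :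
    (Data.searchTrace h S.enc).fst.fst = .opt (S.digest h) ∧
      ∀ T, (Data.searchTrace h S.enc).snd.pairs ⊆ T → S.MsgsIn h T := by
  induction S with
  | empty => exact ⟨rfl, fun _ _ => trivial⟩
  | node l d r ihl ihr =>
    have hV : Data.searchTrace h (SearchTree.node l d r).enc =
        .pair (.pair (.opt ((SearchTree.node l d r).digest h))
            (.pair (Data.searchTrace h d.enc).fst.fst
              (Data.searchTrace h (.pair l.enc r.enc)).fst.fst))
          (.pair (searchMsg d (l.digest h) (r.digest h))
            (.pair (Data.searchTrace h d.enc).snd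
              (Data.searchTrace h (.pair l.enc r.enc)).snd)) := by
      rw [searchMsg, ← ihl.1, ← ihr.1, SearchTree.digest, searchHash, ← ihl.1, ← ihr.1]
      rfl
    refine ⟨by rw [hV]; rfl, fun T hT => ?_⟩
    rw [hV, Data.snd_pair, Data.pairs_pair_subset] at hT
    obtain ⟨-, h1, h2⟩ := hT
    replace h2 := (Data.pairs_pair_subset.1 h2).2.2
    have h3 : (Data.pair (Data.searchTrace h l.enc).snd (Data.searchTrace h r.enc).snd).pairs ⊆ T :=
      (Data.pairs_snd_subset (Data.searchTrace h (.pair l.enc r.enc)).snd).trans h2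
    rw [Data.pairs_pair_subset] at h3
    exact ⟨h1 (Set.mem_insert _ _), ihl.2 T h3.2.1, ihr.2 T h3.2.2⟩

/-- On an encoded chronTree the loop computes the label of the root and collects the messages. -/
theorem chronTrace_enc (t : ChronTree) :
    (Data.chronTrace h t.enc).fst.fst = (t.digest h).enc ∧
      ∀ T, (Data.chronTrace h t.enc).snd.pairs ⊆ T → t.MsgsIn h T := by
  induction t with
  | leaf x => exact ⟨rfl, fun _ _ => trivial⟩
  | node l r ihl ihr =>
    have hV : Data.chronTrace h (ChronTree.node l r).enc =
        .pair (.pair ((ChronTree.node l r).digest h).enc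
            (.pair (Data.chronTrace h (.pair .nil .nil)).fst.fst
              (Data.chronTrace h (.pair l.enc r.enc)).fst.fst))
          (.pair (.pair (l.digest h).enc (r.digest h).enc)
            (.pair (Data.chronTrace h (.pair .nil .nil)).snd
              (Data.chronTrace h (.pair l.enc r.enc)).snd)) := by
      rw [ChronTree.digest, chronHash, Label.enc, ← ihl.1, ← ihr.1]
      rfl
    refine ⟨by rw [hV]; rfl, fun T hT => ?_⟩
    rw [hV, Data.snd_pair, Data.pairs_pair_subset] at hT
    obtain ⟨-, h1, h2⟩ := hT
    replace h2 := (Data.pairs_pair_subset.1 h2).2.2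
    have h3 : (Data.pair (Data.chronTrace h l.enc).snd (Data.chronTrace h r.enc).snd).pairs ⊆ T :=
      (Data.pairs_snd_subset (Data.chronTrace h (.pair l.enc r.enc)).snd).trans h2
    rw [Data.pairs_pair_subset] at h3
    exact ⟨h1 (Set.mem_insert _ _), ihl.2 T h3.2.1, ihr.2 T h3.2.2⟩

theorem pathMsg_enc (v : Data) (a : PathStep) :
    Data.pathMsg (.pair (.pair (.pair .nil .nil) v) a.enc) = a.msg v := by
  obtain ⟨d, _ | _, s⟩ := a <;> rfl

/-- All messages hashed on a search path are found among the subtrees of the final state. -/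
theorem walk_path (p : List PathStep) (v m : Data) (T : Set Data)
    (hT : (Data.walk h Data.pathMsg (.list (p.map PathStep.enc))
      (.pair (.pair (.pair .nil .nil) v)
        (.pair (.list (p.map PathStep.enc)) m))).snd.snd.pairs ⊆ T) :
    m.pairs ⊆ T ∧ pathMsgsIn h T v p := by
  induction p generalizing v m with
  | nil => exact ⟨hT, trivial⟩
  | cons a p ih =>
    rw [List.map_cons, Data.walk_cons, pathMsg_enc, ← PathStep.up_eq h] at hT
    obtain ⟨h1, h2⟩ := ih _ _ hT
    rw [Data.pairs_pair_subset] at h1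
    refine ⟨h1.2.2, h1.2.1 ?_, h2⟩
    unfold PathStep.msg searchMsg
    split_ifs <;> exact Set.mem_insert _ _

/-- All messages hashed in a proof of extension are found among the subtrees of the final state. -/
theorem walk_labels (p : List Label) (v : Label) (m : Data) (T : Set Data)
    (hT : (Data.walk h _root_.id (.list (p.map Label.enc))
      (.pair v.enc (.pair (.list (p.map Label.enc)) m))).snd.snd.pairs ⊆ T) :
    m.pairs ⊆ T ∧ labelMsgsIn h T v p := by
  induction p generalizing v m with
  | nil => exact ⟨hT, trivial⟩
  | cons a p ih =>
    rw [List.map_cons, Data.walk_cons] at hT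
    obtain ⟨h1, h2⟩ := ih (chronHash h v a) _ hT
    rw [Data.pairs_pair_subset] at h1
    exact ⟨h1.2.2, h1.2.1 (Set.mem_insert _ _), h2⟩

end Traces

namespace Code

variable (H : HashFamily)

/-- On `(t, c)`: `Data.searchTrace` of `t` in the context `c`. -/
def searchTrace : Code :=
  fold nil (pair
    (pair (pair (H.hashCode arg (pair left (comp snd (comp fst rightResult)))) nil)
      (pair (comp fst (comp fst leftResult)) (comp fst (comp fst rightResult))))
    (pair (pair left (comp snd (comp fst rightResult)))
      (pair (comp snd leftResult) (comp snd rightResult))))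

theorem eval_searchTrace (t c : Data) :
    (searchTrace H).eval (.pair t c) = Data.searchTrace (H.hashIn c) t := by
  simp [searchTrace, eval_fold, Data.searchTrace]

theorem polyTime_searchTrace : PolyTime {z | z.snd ∈ H.contexts} (searchTrace H) := by
  obtain ⟨P, hP⟩ := H.exists_size_hashIn_le
  refine PolyTime.fold (B := Set.univ) (T := {w | w.snd.snd ∈ H.contexts}) .nil ?_
    (fun _ _ => trivial) (fun z hz _ _ _ _ => hz) ⟨P + Polynomial.X + 20, ?_⟩
  · refine .pair (.pair (.pair ?_ .nil) (.of_loopFree rfl)) (.of_loopFree rfl)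
    exact HashFamily.polyTime_hashCode (.of_loopFree rfl) (.of_loopFree rfl) fun z hz => hz
  · intro z hz l r vl vr hl hr
    have h1 := (hP z.snd hz (.pair l vr.fst.snd)).trans (eval_le_eval P z.size_snd_le)
    have h2 := vl.size_fst_add_size_snd
    have h3 := vr.size_fst_add_size_snd
    have h4 := vl.fst.size_fst_le
    have h5 := vr.fst.size_fst_add_size_snd
    simp only [eval_pair, eval_comp, eval_fst, eval_snd, eval_nil, HashFamily.eval_hashCode,
      Data.fst_pair, Data.snd_pair, Data.size, Polynomial.eval_add, Polynomial.eval_X,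
      Polynomial.eval_ofNat]
    omega

/-- On `(t, c)`: `Data.chronTrace` of `t` in the context `c`. -/
def chronTrace : Code :=
  fold nil (pair
    (pair (cond left (pair left (H.hashCode arg (comp snd (comp fst rightResult))))
        (pair left right))
      (pair (comp fst (comp fst leftResult)) (comp fst (comp fst rightResult))))
    (pair (comp snd (comp fst rightResult)) (pair (comp snd leftResult) (comp snd rightResult))))

theorem eval_chronTrace (t c : Data) :
    (chronTrace H).eval (.pair t c) = Data.chronTrace (H.hashIn c) t := by
  simp [chronTrace, eval_fold, Data.chronTrace]

theorem polyTime_chronTrace : PolyTime {z | z.snd ∈ H.contexts} (chronTrace H) := by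
  obtain ⟨P, hP⟩ := H.exists_size_hashIn_le
  refine PolyTime.fold (B := Set.univ) (T := {w | w.snd.snd ∈ H.contexts}) .nil ?_
    (fun _ _ => trivial) (fun z hz _ _ _ _ => hz) ⟨P + 2 * Polynomial.X + 20, ?_⟩
  · refine .pair (.pair (.cond (.of_loopFree rfl) (.pair (.of_loopFree rfl) ?_)
      (.of_loopFree rfl)) (.of_loopFree rfl)) (.of_loopFree rfl)
    exact HashFamily.polyTime_hashCode (.of_loopFree rfl) (.of_loopFree rfl) fun z hz => hz
  · intro z hz l r vl vr hl hr
    have h1 := (hP z.snd hz vr.fst.snd).trans (eval_le_eval P z.size_snd_le)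
    have h2 := vl.size_fst_add_size_snd
    have h3 := vr.size_fst_add_size_snd
    have h4 := vl.fst.size_fst_le
    have h5 := vr.fst.size_fst_add_size_snd
    have h6 : (Data.ite l (.pair l (H.hashIn z.snd vr.fst.snd)) (.pair l r)).size ≤
        P.eval z.size + 2 * z.size + 1 :=
      Data.size_ite_le _ (by simp only [Data.size]; omega) (by simp only [Data.size]; omega)
    simp only [eval_pair, eval_comp, eval_cond, eval_fst, eval_snd, HashFamily.eval_hashCode,
      Data.fst_pair, Data.snd_pair, Data.size, Polynomial.eval_add, Polynomial.eval_mul,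
      Polynomial.eval_X, Polynomial.eval_ofNat]
    omega

/-- On `(t, c, st)`: `Data.walk` along `t` from the state `st` in the context `c`. -/
def walk (f : Code) : Code :=
  fold snd (pair
    (pair (pair nil nil) (H.hashCode (comp fst arg)
      (comp f (pair (comp fst rightResult) (comp fst (comp fst (comp snd rightResult)))))))
    (pair (comp snd (comp fst (comp snd rightResult)))
      (pair (comp f (pair (comp fst rightResult) (comp fst (comp fst (comp snd rightResult)))))
        (comp snd (comp snd rightResult)))))

theorem eval_walk (f : Code) (t c st : Data) :
    (walk H f).eval (.pair t (.pair c st)) = Data.walk (H.hashIn c) f.eval t st := by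
  simp [walk, eval_fold, Data.walk, Data.walkStep]

theorem polyTime_walk {f : Code} (hf : f.LoopFree = true) {m : ℕ}
    (hm : ∀ v a, (f.eval (.pair v a)).size ≤ v.size + a.size + m) :
    PolyTime {z | z.snd.fst ∈ H.contexts} (walk H f) := by
  obtain ⟨P, hP⟩ := H.exists_size_hashIn_le
  refine PolyTime.fold (B := Set.univ) (T := {w | w.snd.snd.fst ∈ H.contexts}) .snd ?_
    (fun _ _ => trivial) (fun z hz _ _ _ _ => hz) ⟨P + Polynomial.C m + 20, ?_⟩
  · refine .pair (.pair (.of_loopFree rfl) ?_) (.of_loopFree ?_)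
    · exact HashFamily.polyTime_hashCode (.of_loopFree rfl) (.of_loopFree (by simp [LoopFree, hf]))
        fun z hz => hz
    · simp [LoopFree, hf]
  · intro z hz l r vl vr hl hr
    have h1 := (hP z.snd.fst hz (f.eval (.pair vr.fst vr.snd.fst.fst))).trans
      (eval_le_eval P (z.snd.size_fst_le.trans z.size_snd_le))
    have h2 := hm vr.fst vr.snd.fst.fst
    have h3 := vr.size_fst_add_size_snd
    have h4 := vr.snd.size_fst_add_size_snd
    have h5 := vr.snd.fst.size_fst_add_size_snd
    simp only [eval_pair, eval_comp, eval_fst, eval_snd, eval_nil, HashFamily.eval_hashCode,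
      Data.fst_pair, Data.snd_pair, Data.size, Polynomial.eval_add, Polynomial.eval_C,
      Polynomial.eval_ofNat]
    omega

/-- The program for `Data.pathMsg`. -/
def pathMsg : Code :=
  cond (comp fst (comp snd snd))
    (pair (comp fst snd) (pair (comp snd (comp snd snd)) (pair (comp snd fst) nil)))
    (pair (comp fst snd) (pair (pair (comp snd fst) nil) (comp snd (comp snd snd))))

theorem eval_pathMsg : pathMsg.eval = Data.pathMsg := by
  funext z
  simp [pathMsg, Data.pathMsg]

theorem size_eval_pathMsg_le (v a : Data) :
    (pathMsg.eval (.pair v a)).size ≤ v.size + a.size + 10 := by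
  have h1 := v.size_snd_le
  have h2 := a.size_fst_add_size_snd
  have h3 := a.snd.size_snd_le
  rw [eval_pathMsg, Data.pathMsg]
  apply Data.size_ite_le <;> simp only [Data.fst_pair, Data.snd_pair, Data.size] <;> omega

/-- The `i`-th entry of a list. -/
def entry : ℕ → Code
  | 0 => fst
  | i + 1 => comp (entry i) snd

theorem loopFree_entry (i : ℕ) : (entry i).LoopFree = true := by
  induction i <;> simp_all [entry, LoopFree]

/-- On `(c, out)`, where `out` encodes a behaviour: data whose subtrees include the messages that
are hashed in the context `c` in the computation of the root digests and in the verification of the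
proof. The proof is read as a proof of each of the types 1, 3 and 4 in turn. -/
def messages : Code :=
  let body := comp snd (comp (entry 8) snd)
  let start (m path : Code) : Code :=
    pair path (pair fst (pair (pair (pair nil nil) (H.hashCode fst m)) (pair path m)))
  pair (comp (searchTrace H) (pair (comp (entry 4) snd) fst))
    (pair (comp (chronTrace H) (pair (comp (entry 5) snd) fst))
      (pair (comp (chronTrace H) (pair (comp (entry 6) snd) fst))
        (pair
          (comp (walk H pathMsg) (start
            (pair (comp (entry 0) body) (pair (comp (entry 1) body) (comp (entry 2) body)))
            (comp (entry 3) body)))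
          (pair
            (comp (walk H pathMsg) (start (pair (comp fst body) (pair nil nil)) (comp snd body)))
            (comp (walk H id) (pair body (pair fst (pair
              (comp fst (comp fst (comp (chronTrace H) (pair (comp (entry 5) snd) fst))))
              (pair body nil)))))))))

theorem polyTime_messages : PolyTime {z | z.fst ∈ H.contexts} (messages H) := by
  have hs : PolyTime {z | z.fst ∈ H.contexts}
      (comp (searchTrace H) (pair (comp (entry 4) snd) fst)) :=
    (polyTime_searchTrace H).comp (.of_loopFree rfl) fun z hz => hz
  have hc : ∀ i, PolyTime {z | z.fst ∈ H.contexts}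
      (comp (chronTrace H) (pair (comp (entry i) snd) fst)) := fun i =>
    (polyTime_chronTrace H).comp (.of_loopFree (by simp [LoopFree, loopFree_entry])) fun z hz => hz
  have hw : ∀ m path : Code, m.LoopFree = true → path.LoopFree = true →
      PolyTime {z | z.fst ∈ H.contexts} (comp (walk H pathMsg)
        (pair path (pair fst (pair (pair (pair nil nil) (H.hashCode fst m)) (pair path m))))) := by
    intro m path hm hpath
    refine (polyTime_walk H rfl size_eval_pathMsg_le).comp ?_ fun z hz => hz
    refine .pair (.of_loopFree hpath) (.pair .fst (.pair (.pair (.of_loopFree rfl) ?_)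
      (.pair (.of_loopFree hpath) (.of_loopFree hm))))
    exact HashFamily.polyTime_hashCode .fst (.of_loopFree hm) fun z hz => hz
  refine .pair hs (.pair (hc 5) (.pair (hc 6) (.pair (hw _ _ rfl rfl) (.pair (hw _ _ rfl rfl) ?_))))
  refine (polyTime_walk H (f := id) (m := 1) rfl fun v a => by simp [Data.size]).comp
    (.pair (.of_loopFree rfl) (.pair .fst (.pair ?_ (.of_loopFree rfl)))) fun z hz => hz
  exact PolyTime.comp (T := Set.univ) .fst (PolyTime.comp (T := Set.univ) .fst (hc 5)
    fun _ _ => trivial) fun _ _ => trivial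

/-- On `(c, out)`, where `out` encodes a behaviour: a collision in the context `c` among the
messages that are hashed. -/
def findCollision : Code :=
  comp (collision H) (comp (pair snd (pair fst snd)) (pair fst (messages H)))

theorem polyTime_findCollision : PolyTime {z | z.fst ∈ H.contexts} (findCollision H) :=
  (polyTime_collision H).comp
    (PolyTime.comp (T := Set.univ) (.of_loopFree rfl) (.pair .fst (polyTime_messages H))
      fun _ _ => trivial) fun _ hz => hz

theorem eval_findCollision (z : Data) :
    (findCollision H).eval z = Data.collision (H.hashIn z.fst) ((messages H).eval z) :=
  eval_collision H _ _

end Code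

open Code

/-! ### The reduction -/

/-- A false proof that is not detected is accepted, and so it reveals a collision among the hashed
messages. -/
theorem Behaviour.not_injOn_messages (H : HashFamily) (n : ℕ) (k : List Bool)
    {BL : Data → BilinearSetting} (N : GossipNetwork) (F : Behaviour BL)
    (hfalse : ¬ F.ClaimTrue) (hdet : ¬ F.Detected (H.hash n k) N) :
    ¬ Set.InjOn (H.hash n k)
      ((messages H).eval (.pair (.pair (.unary n) (.bits k)) F.enc)).pairs := by
  intro hT
  have hacc : F.Accepted (H.hash n k) := by
    by_contra hacc
    exact hdet (.inl hacc)
  have htype : ¬ F.IsAccumulatorType := fun h =>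
    hdet (F.detected_of_isAccumulatorType _ N h hfalse)
  generalize hW : (messages H).eval (.pair (.pair (.unary n) (.bits k)) F.enc) = W at hT
  have hhash : H.hashIn (.pair (.unary n) (.bits k)) = H.hash n k := rfl
  simp only [messages, eval_pair, eval_comp, eval_fst, eval_snd, eval_searchTrace, eval_chronTrace,
    eval_walk, HashFamily.eval_hashCode, Data.fst_pair, Data.snd_pair, eval_nil, hhash,
    eval_pathMsg, enc, entry, Data.list] at hW
  -- Only the inclusion of the subtrees in `T` is needed to read off the messages.
  obtain ⟨T, hTW⟩ : ∃ T, T = W.pairs := ⟨_, rfl⟩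
  rw [← hTW] at hT
  have hsub : W.pairs ⊆ T := hTW.ge
  rw [← hW] at hsub
  simp only [Data.pairs_pair_subset] at hsub
  obtain ⟨-, hs, -, ho, -, hc, -, h1, -, h3, h4⟩ := hsub
  replace hs := (searchTrace_enc (H.hash n k) F.search).2 T ((Data.pairs_snd_subset _).trans hs)
  replace ho := (chronTrace_enc (H.hash n k) F.oldChron).2 T ((Data.pairs_snd_subset _).trans ho)
  replace hc := (chronTrace_enc (H.hash n k) F.chron).2 T ((Data.pairs_snd_subset _).trans hc)
  have hsnd : ∀ z : Data, z.snd.snd.pairs ⊆ z.pairs := fun z =>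
    (Data.pairs_snd_subset _).trans (Data.pairs_snd_subset _)
  replace h1 := (hsnd _).trans h1
  replace h3 := (hsnd _).trans h3
  replace h4 := (hsnd _).trans h4
  unfold Accepted at hacc
  generalize hQ : F.query = Q at hacc
  generalize F.proof = π at hacc h1 h3 h4
  unfold ClaimTrue at hfalse
  rw [hQ] at hfalse
  cases Q with
  | absence c => exact htype ⟨c, .inl hQ⟩
  | currency c => exact htype ⟨c, .inr hQ⟩
  | presence c =>
    cases π with
    | presence d a b path =>
      obtain ⟨hd, hk, heq⟩ := hacc
      obtain ⟨hm, hp⟩ := walk_path (H.hash n k) path _ _ T h1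
      exact hfalse ⟨d, SearchTree.mem_items_of_path hT (hm (Set.mem_insert _ _)) path hs hp heq,
        hd, hk⟩
    | _ => exact hacc
  | ownerAbsence u =>
    cases π with
    | ownerAbsence d path =>
      obtain ⟨hu, hpu, heq⟩ := hacc
      obtain ⟨hm, hp⟩ := walk_path (H.hash n k) path _ _ T h3
      exact hfalse (SearchTree.not_mem_items_of_path hT (hm (Set.mem_insert _ _)) hu path hpu hs
        F.search_sorted hp heq)
    | _ => exact hacc
  | extension =>
    cases π with
    | extension hs' =>
      rw [(chronTrace_enc (H.hash n k) F.oldChron).1] at h4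
      obtain ⟨-, hp⟩ := walk_labels (H.hash n k) hs' _ _ T h4
      exact hfalse (ChronTree.leaves_prefix_of_path hT ho hs' hc hp hacc)
    | _ => exact hacc

/-- The algorithm that runs the maintainer `M` on the same key and coins and looks for a collision
in its output. -/
def reduction (H : HashFamily) (M : Code) : Code :=
  comp (findCollision H) (pair (pair fst (comp fst snd)) M)

/-- The running time is polynomial in the size of the input `(1ⁿ, k, r)`, and that size is
polynomial in `n`. -/
theorem isPPT_reduction (H : HashFamily) {coins : ℕ → ℕ} {M : Code} (hM : IsPPT H.keyLen coins M) :
    IsPPT H.keyLen coins (reduction H M) := by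
  obtain ⟨P, hP⟩ := hM
  let S : Set Data := {z | ∃ n k r, k.length = H.keyLen n ∧ r.length = coins n ∧
    z = algInput n k r}
  have hMS : PolyTime S M := by
    refine (PolyBounded.size.eval P).mono ?_
    rintro _ ⟨n, k, r, hk, hr, rfl⟩
    refine ((hP n).2 k r hk hr).trans (eval_le_eval P ?_)
    have := Data.le_size_unary n
    simp only [algInput, Data.size]
    omega
  have hS : PolyTime S (reduction H M) := by
    refine (polyTime_findCollision H).comp (.pair (.of_loopFree rfl) hMS) ?_
    rintro _ ⟨n, k, r, hk, hr, rfl⟩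
    exact ⟨n, k, hk, rfl⟩
  obtain ⟨Q, hQ⟩ := hS
  let R : Polynomial ℕ := Q.comp (4 * Polynomial.X + 4 * H.bound + 4 * P + 5)
  refine ⟨P + R, fun n => ⟨(hP n).1.trans (by simp), fun k r hk hr => ?_⟩⟩
  refine (hQ _ ⟨n, k, r, hk, hr, rfl⟩).trans ?_
  have hsize : (algInput n k r).size ≤ 4 * n + 4 * H.bound.eval n + 4 * P.eval n + 5 := by
    have h1 := Data.size_bits_le (List.replicate n true)
    have h2 := Data.size_bits_le k
    have h3 := Data.size_bits_le r
    have h4 := H.keyLen_le n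
    have h5 := (hP n).1
    simp only [List.length_replicate] at h1
    simp only [algInput, Data.unary, Data.size]
    omega
  refine (eval_le_eval Q hsize).trans ?_
  simp [R]

theorem uniformProb_mono (α : Type) [Fintype α] {E E' : α → Prop} (h : ∀ a, E a → E' a) :
    uniformProb α E ≤ uniformProb α E' := by
  unfold uniformProb
  gcongr
  exact Nat.card_le_card_of_injective (Subtype.map _root_.id h)
    (Subtype.map_injective h Function.injective_id)

end CT

/-- A log maintainer who knows the trapdoor cannot give a false proof without being detected by the
auditor or the domain owner: never for the accumulator proofs (types 2 and 5), and only with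
negligible probability for proofs of arbitrary type. -/
theorem lemma4 (H : CT.HashFamily) (hH : H.CollisionResistant)
    (BL : ℕ → CT.Data → CT.BilinearSetting) (N : ℕ → CT.GossipNetwork) :
    (∀ (n : ℕ) (k : List Bool) (F : CT.Behaviour (BL n)),
      F.IsAccumulatorType → ¬ F.ClaimTrue → F.Detected (H.hash n k) (N n)) ∧
    (∀ (coins : ℕ → ℕ) (M : CT.Code), CT.IsPPT H.keyLen coins M →
      CT.Negligible fun n => CT.outputProb H.keyLen coins M n fun k out =>
        ∃ F : CT.Behaviour (BL n), F.enc = out ∧ ¬ F.ClaimTrue ∧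
          ¬ F.Detected (H.hash n k) (N n)) := by
  refine ⟨fun n k F hF hfalse => F.detected_of_isAccumulatorType _ _ hF hfalse, ?_⟩
  intro coins M hM c hc
  filter_upwards [hH coins _ (CT.isPPT_reduction H hM) c hc] with n hn
  refine (CT.uniformProb_mono _ ?_).trans_lt hn
  rintro ω ⟨F, hF, hfalse, hdet⟩
  obtain ⟨x, y, hxy⟩ := CT.Data.collision_spec (F.not_injOn_messages H n _ (N n) hfalse hdet)
  refine ⟨x, y, ?_, hxy.2⟩
  rw [← hxy.1, hF]
  exact CT.Code.eval_findCollision H _
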